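/- Let $n$ be a natural number. Let $B_n$ be the braid group on $n$ strands, with standard generators $\sigma_1,\dots,\sigma_{n-1}$ and the Artin relations $\sigma_i\sigma_j=\sigma_j\sigma_i$ for $|i-j|\ge 2$ and $\sigma_i\sigma_{i+1}\sigma_i=\sigma_{i+1}\sigma_i\sigma_{i+1}$. Let $B_n^+$ be the monoid with the same presentation ($B_n$ and $B_n^+$ are trivial if $n\le 1$). A standard word is a word in the letters $\sigma_i^{\pm1}$, a positive word is a word in the letters $\sigma_i$, and $\equiv$ denotes equality of the represented elements. Let $\Delta=(\sigma_1\cdots\sigma_{n-1})(\sigma_1\cdots\sigma_{n-2})\cdots(\sigma_1\sigma_2)\sigma_1$. *Fixed standard division.* For every $1\le i<n$ fix a positive word $D_i$ of length $n(n-1)/2-1$ with $D_i\equiv\Delta\sigma_i^{-1}$ in $B_n$. An extended letter is ${}_a\sigma_i$ or ${}_a\sigma_i^{-1}$ with $a\in\mathbb Z/4\mathbb Z$; for $d\in\mathbb Z/4\mathbb Z$, let $\mathrm{sh}(d,{}_a\sigma_i^{e})={}_{a+d}\sigma_i^{f}$ with $f=e$ if $d\in\{0,2\}$ and $f=-e$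 otherwise. The separation of an extended word is the triple $(L,\delta,L')$, where $L,L'$ are lists in $\mathbb Z/4\mathbb Z$ and $\delta\in\mathbb Z/4\mathbb Z$, defined inductively: that of the empty word is $([\,],0,[\,])$, and if that of $W$ is $(L,\delta,L')$, then that of $W.x$ is $(L,\delta,L'.[-\delta])$ if $x$ is negative, $(L.[0],\delta,L')$ if $x$ is positive and $L'=[\,]$, and $(L.[a+\delta-1],\delta+2,L''.[1-\delta])$ if $x$ is positive and $L'=[a].L''$. Given a standard word $V$, replace each letter $\sigma_i^{\pm1}$ by ${}_0\sigma_i^{\pm1}$ to get an extended word $W=w_1\cdots w_k$ with separation $(L,\delta,L')$, let $d_1,\dots,d_k$ be the list $L$ followed by the elements $\delta+d$ for $d$ in $L'$, and put $w_q'=\mathrm{sh}(d_q,w_q)$. Let $P_e$ be the word formed by the first $|L|$ letters $w_q'$ (these are positive), and $Q_e$ the formal inverse of the word formed by the remaining (negative) ones. Replacing in $P_e$ and in $Q_e$ every ${}_0\sigma_i$ by $\sigma_i$, every ${}_1\sigma_i$ by $D_i$, every ${}_2\sigma_i$ by $\sigma_{n-i}$ and every ${}_3\sigma_i$ by $D_{n-i}$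 gives two positive words $P$ and $Q$; $P\cdot Q^{-1}$ is the fixed standard division of $V$. **Theorem 5 (word problems reduction).** For every fixed $n$, words $D_i$ as above exist, and for every choice of them: 1. $V\equiv P\cdot Q^{-1}$ in $B_n$ for every standard word $V$ with fixed standard division $P\cdot Q^{-1}$; 2. the map that sends a pair $(X,Y)$ of standard words to the pair $(P,Q)$, where $P\cdot Q^{-1}$ is the fixed standard division of $X\cdot Y^{-1}$, is a linear time reduction of the word problem in $B_n$ to the word problem in $B_n^+$ on positive words. That is, it is computable by a multi-stack (equivalently, multitape) Turing machine in $O(|X|+|Y|+1)$ steps, with a constant that depends only on $n$ and the words $D_i$, and for all standard words $X,Y$ one has $X\equiv Y$ in $B_n$ if and only if $P\equiv Q$ in $B_n^+$. -/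

import Mathlib

/-! ### Braid groups, braid monoids and words

The generator `σ_{i+1}` of the braid group (or monoid) on `n` strands is indexed by
`i : Fin (n - 1)`, so that `σ_{n-i}` corresponds to `Fin.rev`. -/

/-- The Artin relations between positive words: far commutation and the braid relation. -/
inductive BraidRel (n : ℕ) : FreeMonoid (Fin (n - 1)) → FreeMonoid (Fin (n - 1)) → Prop
  | comm (i j : Fin (n - 1)) (h : i.val + 1 < j.val) :
      BraidRel n (FreeMonoid.of i * FreeMonoid.of j) (FreeMonoid.of j * FreeMonoid.of i)
  | braid (i j : Fin (n - 1)) (h : i.val + 1 = j.val) :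
      BraidRel n (FreeMonoid.of i * FreeMonoid.of j * FreeMonoid.of i)
        (FreeMonoid.of j * FreeMonoid.of i * FreeMonoid.of j)

/-- The positive braid monoid `B_n^+`. -/
abbrev BraidMonoid (n : ℕ) : Type := PresentedMonoid (BraidRel n)

/-- The relators `u v⁻¹`, for `u = v` an Artin relation. -/
def braidRelators (n : ℕ) : Set (FreeGroup (Fin (n - 1))) :=
  {r | ∃ u v : FreeMonoid (Fin (n - 1)), BraidRel n u v ∧
    r = FreeMonoid.lift FreeGroup.of u * (FreeMonoid.lift FreeGroup.of v)⁻¹}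

/-- The braid group `B_n`. -/
abbrev BraidGroup (n : ℕ) : Type := PresentedGroup (braidRelators n)

/-- Standard words: `(i, true)` is the letter `σ_{i+1}` and `(i, false)` its inverse. -/
abbrev StdWord (n : ℕ) : Type := List (Fin (n - 1) × Bool)

/-- Positive standard words. -/
abbrev PosWord (n : ℕ) : Type := List (Fin (n - 1))

/-- The braid represented by a standard word. -/
def StdWord.toGroup {n : ℕ} (V : StdWord n) : BraidGroup n :=
  PresentedGroup.mk (braidRelators n) (FreeGroup.mk V)

/-- The formal inverse of a standard word. -/
def StdWord.inv {n : ℕ} (V : StdWord n) : StdWord n :=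
  (V.map fun x => (x.1, !x.2)).reverse

/-- A positive word, seen as a standard word. -/
def PosWord.toStd {n : ℕ} (P : PosWord n) : StdWord n := P.map fun i => (i, true)

/-- The positive braid represented by a positive word, in the monoid `B_n^+`. -/
def PosWord.toMonoid {n : ℕ} (P : PosWord n) : BraidMonoid n :=
  PresentedMonoid.mk (BraidRel n) (FreeMonoid.ofList P)

/-- The positive word `(σ_1 ⋯ σ_{n-1}) (σ_1 ⋯ σ_{n-2}) ⋯ (σ_1 σ_2) σ_1` of the half turn `Δ`. -/
def deltaWord (n : ℕ) : PosWord n :=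
  (List.range n).reverse.flatMap fun k => (List.finRange (n - 1)).filter fun i => i.val < k

/-- `D` chooses, for every `i`, a positive word `D_i` of length `n (n - 1) / 2 - 1` that is
equivalent to `Δ σ_i⁻¹` in `B_n`. -/
def IsDeltaQuotient (n : ℕ) (D : Fin (n - 1) → PosWord n) : Prop :=
  ∀ i, (D i).length = n * (n - 1) / 2 - 1 ∧
    (D i).toStd.toGroup = StdWord.toGroup ((deltaWord n).toStd ++ [(i, false)])

/-! ### Extended words and their division -/

/-- The extended letter `_aσ_i` (if `pos`) or its inverse (if not). Here `_0σ_i = σ_i`,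
`_1σ_i = Δ σ_i⁻¹`, `_2σ_i = σ_{n-i}` and `_3σ_i = Δ σ_{n-i}⁻¹`. -/
structure ExtLetter (n : ℕ) where
  a : ZMod 4
  idx : Fin (n - 1)
  pos : Bool

/-- Positive extended letters `_aσ_i`. -/
abbrev PosExtLetter (n : ℕ) : Type := ZMod 4 × Fin (n - 1)

/-- The extension of a standard word: `σ_i` becomes `_0σ_i`. -/
def StdWord.extend {n : ℕ} (V : StdWord n) : List (ExtLetter n) := V.map fun x => ⟨0, x.1, x.2⟩

/-- The shift `sh(d, x)` of an extended letter: the left index is translated by `d`, and the sign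
changes exactly if `d` is odd. -/
def ExtLetter.shift {n : ℕ} (d : ZMod 4) (x : ExtLetter n) : ExtLetter n :=
  ⟨x.a + d, x.idx, if d = 0 ∨ d = 2 then x.pos else !x.pos⟩

/-- A triple `(L, δ, L')`. -/
structure Trip where
  L : List (ZMod 4)
  δ : ZMod 4
  L' : List (ZMod 4)

/-- The effect on the separation of appending a letter to a word; only its sign matters. A positive
letter that moves left across a nonempty block of negative letters exchanges its sign with the
first of them, by `_aσ_i⁻¹ · _bσ_j = _{a-1}σ_i · _{b-1}σ_j⁻¹`; both are translated by `-1`, and the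
letters between are translated twice. -/
def Trip.append (t : Trip) (pos : Bool) : Trip :=
  match pos, t.L' with
  | false, _ => ⟨t.L, t.δ, t.L' ++ [-t.δ]⟩
  | true, [] => ⟨t.L ++ [0], t.δ, []⟩
  | true, a :: L'' => ⟨t.L ++ [a + t.δ - 1], t.δ + 2, L'' ++ [1 - t.δ]⟩

/-- The separation of an extended word. -/
def separation {n : ℕ} (W : List (ExtLetter n)) : Trip :=
  W.foldl (fun t x => t.append x.pos) ⟨[], 0, []⟩

/-- The bishift `SH2(L, δ, L', W)`. -/
def bishift {n : ℕ} (t : Trip) (W : List (ExtLetter n)) : List (ExtLetter n) :=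
  List.zipWith ExtLetter.shift (t.L ++ t.L'.map fun d => t.δ + d) W

/-- Extended division: the bishift of `W` by its separation `(L, δ, L')` is `P · Q⁻¹`, where `P`
consists of the first `|L|` letters. -/
def extDivision {n : ℕ} (W : List (ExtLetter n)) : List (PosExtLetter n) × List (PosExtLetter n) :=
  let t := separation W
  let W' := (bishift t W).map fun x => (x.a, x.idx)
  (W'.take t.L.length, (W'.drop t.L.length).reverse)

/-- The positive standard word that replaces a positive extended letter. -/
def standardizeLetter {n : ℕ} (D : Fin (n - 1) → PosWord n) (x : PosExtLetter n) : PosWord n :=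
  if x.1 = 0 then [x.2]
  else if x.1 = 1 then D x.2
  else if x.1 = 2 then [x.2.rev]
  else D x.2.rev

/-- The standardization `S(W)` of a positive extended word. -/
def standardize {n : ℕ} (D : Fin (n - 1) → PosWord n) (W : List (PosExtLetter n)) : PosWord n :=
  W.flatMap (standardizeLetter D)

/-- The fixed standard division `(P, Q)` of a standard word. -/
def stdDivision {n : ℕ} (D : Fin (n - 1) → PosWord n) (V : StdWord n) : PosWord n × PosWord n :=
  let E := extDivision V.extend
  (standardize D E.1, standardize D E.2)

/-! ### Word problems and linear time reductions -/

/-- The word problem of `B_n`: the pairs of standard words that represent the same braid. -/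
def groupWordProblem (n : ℕ) : Set (StdWord n × StdWord n) :=
  {w | w.1.toGroup = w.2.toGroup}

/-- The word problem of `B_n^+`, on pairs of positive words. -/
def monoidWordProblem (n : ℕ) : Set (PosWord n × PosWord n) :=
  {w | w.1.toMonoid = w.2.toMonoid}

/-- A pair of words over `A`, written as one word with the separator `none`. -/
def encodePair {A : Type} (w : List A × List A) : List (Option A) :=
  w.1.map some ++ none :: w.2.map some

/-- `f` is computed by a multi-stack Turing machine (finitely many stacks, stack symbols, labels and
internal states) in a number of steps that is linear in the length of the input. -/
def ComputableInLinearTime {α β A B : Type} (ea : α → List A) (eb : β → List B) (f : α → β) :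
    Prop :=
  ∃ M : Turing.TM2ComputableInTime ea eb f,
    (∀ k, Finite (M.tm.Γ k)) ∧ ∃ c : ℕ, ∀ m, M.time m ≤ c * (m + 1)

/-- `f` is a linear time many-one reduction of the problem `S` to the problem `T`. -/
def IsLinearTimeReduction {α β A B : Type} (ea : α → List A) (eb : β → List B) (f : α → β)
    (S : Set α) (T : Set β) : Prop :=
  ComputableInLinearTime ea eb f ∧ ∀ x, x ∈ S ↔ f x ∈ T

/-! Correctness of the division rests on one identity: `_{a+1}σ_i · _aσ_i = Δ` for every `a` modulo
4 (`standardizeLetter_add_one`). It gives `_aσ_i⁻¹ = _{a-1}σ_i · Δ⁻¹` and `_bσ_j = Δ ·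
(_{b-1}σ_j)⁻¹`, so a negative letter followed by a positive one becomes a positive letter followed
by a negative one, with the same underlying generators in the same order and only the left indices
translated. Iterating this moves all positive signs to the left, and the separation records the
total translation of each letter (`exists_bishift_eq`, `toGroup_stdDivision`).

Hence `X ≡ Y` exactly if `P` and `Q` agree in the braid group. Descending to the monoid requires
Garside's embedding theorem, `toBraidGroup_injective`. Its ingredients are left cancellation, which
comes from the least common multiples of pairs of generators (`lcmUpTo`), and a central element `Δ²`
that is divisible by every generator. Inverting `Δ²` then loses no information, makes every
generator a unit, and yields a monoid whose units receive the braid group.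

For linear time, the list `L'` is a queue: entries join at its end, and each positive letter removes
the front entry, combined with the current `δ`. A positive letter that meets an empty queue may be
thought of as removing its own entry, since `(1 - δ) + δ - 1 = 0`. So the `q`-th positive letter
always removes the `q`-th entry ever added, and it suffices to record all entries and all values of
`δ` on two stacks and to match them at the end (`exists_separation_eq`). -/

/-! ### Left cancellation in the braid monoid -/

namespace BraidMonoid

variable {n : ℕ}

/-- The generators of the braid monoid. -/
def gen (i : Fin (n - 1)) : BraidMonoid n := PresentedMonoid.of (BraidRel n) i

/-- Two generators are adjacent if they satisfy the braid relation. -/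
def Adj (i j : Fin (n - 1)) : Prop := i.val + 1 = j.val ∨ j.val + 1 = i.val

instance (i j : Fin (n - 1)) : Decidable (Adj i j) := inferInstanceAs (Decidable (_ ∨ _))

theorem Adj.symm {i j : Fin (n - 1)} (h : Adj i j) : Adj j i := Or.symm h

theorem Adj.ne {i j : Fin (n - 1)} (h : Adj i j) : i ≠ j := by
  rintro rfl
  rcases h with h | h <;> omega

theorem gen_comm {i j : Fin (n - 1)} (h : ¬ Adj i j) : gen i * gen j = gen j * gen i := by
  rcases eq_or_ne i j with rfl | hij
  · rfl
  have hv : i.val ≠ j.val := fun e => hij (Fin.ext e)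
  unfold Adj at h
  rcases Nat.lt_or_gt_of_ne hv with hl | hl
  · exact PresentedMonoid.mk_eq_mk_of_rel (BraidRel.comm i j (by omega))
  · exact (PresentedMonoid.mk_eq_mk_of_rel (BraidRel.comm j i (by omega))).symm

theorem gen_comm_mul {i j : Fin (n - 1)} (h : ¬ Adj i j) (x : BraidMonoid n) :
    gen i * (gen j * x) = gen j * (gen i * x) := by
  rw [← mul_assoc, gen_comm h, mul_assoc]

theorem gen_braid {i j : Fin (n - 1)} (h : Adj i j) :
    gen i * gen j * gen i = gen j * gen i * gen j := by
  rcases h with h | h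
  · exact PresentedMonoid.mk_eq_mk_of_rel (BraidRel.braid i j h)
  · exact (PresentedMonoid.mk_eq_mk_of_rel (BraidRel.braid j i h)).symm

theorem gen_braid_mul {i j : Fin (n - 1)} (h : Adj i j) (x : BraidMonoid n) :
    gen i * (gen j * (gen i * x)) = gen j * (gen i * (gen j * x)) := by
  have := congrArg (· * x) (gen_braid h)
  simpa only [mul_assoc] using this

/-- The length homomorphism. -/
def lenHom (n : ℕ) : BraidMonoid n →* Multiplicative ℕ :=
  PresentedMonoid.lift (fun _ => Multiplicative.ofAdd 1) (by
    intro a b h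
    cases h <;> simp)

/-- The common length of all words that represent a positive braid. -/
def len (x : BraidMonoid n) : ℕ := (lenHom n x).toAdd

@[simp] theorem len_mul (x y : BraidMonoid n) : len (x * y) = len x + len y := by
  simp [len]

@[simp] theorem len_gen (i : Fin (n - 1)) : len (gen i) = 1 := by
  simp [len, lenHom, gen]

theorem len_mk (w : FreeMonoid (Fin (n - 1))) :
    len (PresentedMonoid.mk (BraidRel n) w) = w.length := by
  induction w using FreeMonoid.inductionOn' with
  | one => simp [len]
  | of_mul i w ih =>
    rw [map_mul, len_mul, ih, FreeMonoid.length_mul, FreeMonoid.length_of]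
    exact congrArg (· + _) (len_gen i)

/-- The right complement of one generator in another: `gen i * compl i j` is their least common
right multiple. -/
def compl (i j : Fin (n - 1)) : BraidMonoid n :=
  if i = j then 1 else if Adj i j then gen j * gen i else gen j

@[simp] theorem compl_self (i : Fin (n - 1)) : compl i i = 1 := if_pos rfl

theorem compl_adj {i j : Fin (n - 1)} (h : Adj i j) : compl i j = gen j * gen i := by
  rw [compl, if_neg h.ne, if_pos h]

theorem compl_far {i j : Fin (n - 1)} (h : i ≠ j) (h' : ¬ Adj i j) : compl i j = gen j := by
  rw [compl, if_neg h, if_neg h']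

/-- Up to length `m`, the common right multiples of two generators are multiples of their
least common right multiple. -/
def LcmUpTo (n m : ℕ) : Prop :=
  ∀ (i j : Fin (n - 1)) (x y : BraidMonoid n), len x + 1 ≤ m → gen i * x = gen j * y →
    ∃ z, x = compl i j * z ∧ y = compl j i * z

/-! ### Least common multiples of generators: the cube condition -/

theorem LcmUpTo.cancel {m : ℕ} (H : LcmUpTo n m) {i : Fin (n - 1)} {x y : BraidMonoid n}
    (hl : len x + 1 ≤ m) (h : gen i * x = gen i * y) : x = y := by
  obtain ⟨z, hx, hy⟩ := H i i x y hl h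
  rw [hx, hy]

theorem LcmUpTo.far {m : ℕ} (H : LcmUpTo n m) {i j : Fin (n - 1)} (hij : i ≠ j) (hf : ¬ Adj i j)
    {x y : BraidMonoid n} (hl : len x + 1 ≤ m) (h : gen i * x = gen j * y) :
    ∃ z, x = gen j * z ∧ y = gen i * z := by
  have := H i j x y hl h
  rwa [compl_far hij hf, compl_far hij.symm (fun e => hf e.symm)] at this

theorem LcmUpTo.adj {m : ℕ} (H : LcmUpTo n m) {i j : Fin (n - 1)} (ha : Adj i j)
    {x y : BraidMonoid n} (hl : len x + 1 ≤ m) (h : gen i * x = gen j * y) :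
    ∃ z, x = gen j * (gen i * z) ∧ y = gen i * (gen j * z) := by
  have := H i j x y hl h
  simpa only [compl_adj ha, compl_adj ha.symm, mul_assoc] using this

/-- One of the nontrivial cases of `LcmUpTo.trans`, after the first letter `k` of the middle word
has been removed. The remaining equation is short enough for `H`, which is applied until all factors
are explicit; the braid relations then rearrange them. -/
theorem LcmUpTo.trans_adj_far {m : ℕ} (H : LcmUpTo n m) {i k j : Fin (n - 1)} (hik : Adj i k)
    (hkj : k ≠ j) (hkj' : ¬ Adj k j) (hij : i ≠ j) {z z' : BraidMonoid n} (hl : len z + 2 ≤ m)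
    (h : gen i * (gen k * z) = gen j * z') :
    ∃ w, gen k * (gen i * z) = compl i j * w ∧ gen k * z' = compl j i * w := by
  by_cases ha : Adj i j
  · obtain ⟨a, h1, rfl⟩ := H.adj ha (by simp; omega) h
    obtain ⟨b, rfl, h2⟩ := H.far hkj hkj' (by omega) h1
    have hl' := congrArg len h2
    simp only [len_mul, len_gen] at hl hl'
    obtain ⟨c, rfl, rfl⟩ := H.adj hik (by omega) h2
    refine ⟨gen k * (gen i * (gen j * c)), ?_, ?_⟩
    · rw [compl_adj ha, mul_assoc, gen_braid_mul ha, gen_comm_mul hkj',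
        ← gen_comm_mul hkj' c, gen_braid_mul hik.symm]
    · rw [compl_adj ha.symm, mul_assoc, ← gen_comm_mul hkj' (gen i * c),
        gen_braid_mul hik.symm, gen_braid_mul ha, gen_comm_mul hkj']
  · obtain ⟨a, h1, rfl⟩ := H.far hij ha (by simp; omega) h
    obtain ⟨b, rfl, rfl⟩ := H.far hkj hkj' (by omega) h1
    refine ⟨gen k * (gen i * b), ?_, ?_⟩
    · rw [compl_far hij ha, gen_comm_mul ha, gen_comm_mul hkj']
    · rw [compl_far hij.symm (fun e => ha e.symm), gen_braid_mul hik]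

theorem LcmUpTo.trans_adj_adj {m : ℕ} (H : LcmUpTo n m) {i k j : Fin (n - 1)} (hik : Adj i k)
    (hkj : Adj k j) (hij : i ≠ j) {z z' : BraidMonoid n} (hl : len z + 2 ≤ m)
    (h : gen i * (gen k * z) = gen j * (gen k * z')) :
    ∃ w, gen k * (gen i * z) = compl i j * w ∧ gen k * (gen j * z') = compl j i * w := by
  -- Two distinct neighbours of `k` are `k - 1` and `k + 1`, hence far apart.
  have ha : ¬ Adj i j := by
    have hv : i.val ≠ j.val := fun e => hij (Fin.ext e)
    unfold Adj at *
    omega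
  obtain ⟨a, h1, h2⟩ := H.far hij ha (by simp; omega) h
  obtain ⟨b, rfl, rfl⟩ := H.adj hkj (by omega) h1
  have hl' := congrArg len h2
  simp only [len_mul, len_gen] at hl hl'
  obtain ⟨c, rfl, h3⟩ := H.adj hik.symm (by omega) h2
  have h4 := H.cancel (by simp; omega) h3
  obtain ⟨e, rfl, rfl⟩ := H.far hij.symm (fun e => ha e.symm) (by omega) h4
  refine ⟨gen k * (gen j * (gen i * (gen k * e))), ?_, ?_⟩
  · rw [compl_far hij ha, gen_comm_mul ha, gen_braid_mul hik, gen_braid_mul hkj]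
  · have ha' : ¬ Adj j i := fun e => ha e.symm
    rw [compl_far hij.symm ha', gen_comm_mul ha' (gen k * (gen j * e)), gen_braid_mul hkj.symm,
      gen_braid_mul hik.symm, gen_comm_mul ha]

/-- The transitivity step of Garside's argument, along `i x = k u = j y`. The two factorizations of
`u` form an equation of length at most `m`, one less than that of the three words, so `H` applies to
it. -/
theorem LcmUpTo.trans {m : ℕ} (H : LcmUpTo n m) {i k j : Fin (n - 1)} {x u y z z' : BraidMonoid n}
    (hl : len u + 1 ≤ m + 1) (hx : x = compl i k * z) (hu : u = compl k i * z)
    (hu' : u = compl k j * z') (hy : y = compl j k * z') :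
    ∃ w, x = compl i j * w ∧ y = compl j i * w := by
  rcases eq_or_ne i k with rfl | hik
  · exact ⟨z', by rw [hx, ← hu', hu], hy⟩
  rcases eq_or_ne k j with rfl | hkj
  · exact ⟨z, hx, by rw [hy, ← hu, hu']⟩
  have hl1 := congrArg len hu
  have hl2 := congrArg len hu'
  have hu2 := hu.symm.trans hu'
  rcases eq_or_ne i j with rfl | hij
  -- As `compl i i = 1`, the claim is `x = y`, which follows from `z = z'` by cancelling `compl k i`
  -- within the bound of `H`.
  · refine ⟨x, by simp, ?_⟩
    by_cases ha : Adj k i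
    · simp only [compl_adj ha, mul_assoc] at hu2
      simp only [compl_adj ha, len_mul, len_gen] at hl1
      have := H.cancel (by omega) (H.cancel (by simp; omega) hu2)
      rw [hx, hy, this, compl_self, one_mul]
    · simp only [compl_far hkj ha] at hu2 hl1
      simp only [len_mul, len_gen] at hl1
      have := H.cancel (by omega) hu2
      rw [hx, hy, this, compl_self, one_mul]
  by_cases ha : Adj i k
  · rw [compl_adj ha, mul_assoc] at hx
    rw [compl_adj ha.symm, mul_assoc] at hu2 hl1
    simp only [len_mul, len_gen] at hl1
    by_cases hb : Adj k j
    · rw [compl_adj hb.symm, mul_assoc] at hy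
      rw [compl_adj hb, mul_assoc] at hu2
      rw [hx, hy]
      exact H.trans_adj_adj ha hb hij (by omega) hu2
    · rw [compl_far hkj.symm (fun e => hb e.symm)] at hy
      rw [compl_far hkj hb] at hu2
      rw [hx, hy]
      exact H.trans_adj_far ha hkj hb hij (by omega) hu2
  · rw [compl_far hik ha] at hx
    rw [compl_far hik.symm (fun e => ha e.symm)] at hu2 hl1
    simp only [len_mul, len_gen] at hl1
    by_cases hb : Adj k j
    · rw [compl_adj hb.symm, mul_assoc] at hy
      rw [compl_adj hb, mul_assoc] at hu2 hl2
      simp only [len_mul, len_gen] at hl2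
      rw [hx, hy]
      obtain ⟨w, h1, h2⟩ :=
        H.trans_adj_far hb.symm hik.symm (fun e => ha e.symm) hij.symm (by omega) hu2.symm
      exact ⟨w, h2, h1⟩
    · rw [compl_far hkj.symm (fun e => hb e.symm)] at hy
      rw [compl_far hkj hb] at hu2
      -- Here `k` commutes with both `i` and `j`, so it moves past their complements, whichever form
      -- these have.
      obtain ⟨t, rfl, rfl⟩ := H i j z z' (by omega) hu2
      refine ⟨gen k * t, ?_, ?_⟩
      · rw [hx, compl, if_neg hij]
        split_ifs
        · rw [mul_assoc, mul_assoc, gen_comm_mul hb, gen_comm_mul fun e => ha e.symm]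
        · rw [gen_comm_mul hb]
      · rw [hy, compl, if_neg hij.symm]
        split_ifs
        · rw [mul_assoc, mul_assoc, gen_comm_mul fun e => ha e.symm, gen_comm_mul hb]
        · rw [gen_comm_mul fun e => ha e.symm]

/-- Either both words are empty, or their tails are the multiples, by the same element, of the
complements of their first letters. -/
def CommonMultiple (w v : FreeMonoid (Fin (n - 1))) : Prop :=
  w = 1 ∧ v = 1 ∨ ∃ i j x y, ∃ z : BraidMonoid n, w = .of i * x ∧ v = .of j * y ∧
    PresentedMonoid.mk (BraidRel n) x = compl i j * z ∧
    PresentedMonoid.mk (BraidRel n) y = compl j i * z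

/-- Induction over the derivation of a congruence. The bound is transported along it because the
relations preserve length; only transitivity needs `H`. -/
theorem LcmUpTo.commonMultiple {m : ℕ} (H : LcmUpTo n m) {w v : FreeMonoid (Fin (n - 1))}
    (h : ConGen.Rel (BraidRel n) w v) (hl : w.length ≤ m + 1) : CommonMultiple w v := by
  have refl (w : FreeMonoid (Fin (n - 1))) : CommonMultiple w w := by
    induction w using FreeMonoid.casesOn with
    | one => exact Or.inl ⟨rfl, rfl⟩
    | of_mul i x => exact Or.inr ⟨i, i, x, x, .mk _ x, rfl, rfl, by simp, by simp⟩
  have length_eq {w v : FreeMonoid (Fin (n - 1))} (h : ConGen.Rel (BraidRel n) w v) :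
      w.length = v.length := by
    rw [← len_mk, ← len_mk, PresentedMonoid.mk_eq_mk_iff.2 h]
  have cons_inj {i j : Fin (n - 1)} {x y : FreeMonoid (Fin (n - 1))}
      (h : FreeMonoid.of i * x = .of j * y) : i = j ∧ x = y := by
    simpa using congrArg FreeMonoid.toList h
  induction h with
  | of x y h =>
    cases h with
    | comm i j h =>
      have ha : ¬ Adj i j := by unfold Adj; omega
      have hij : i ≠ j := by rintro rfl; omega
      exact Or.inr ⟨i, j, .of j, .of i, 1, rfl, rfl, by rw [compl_far hij ha, mul_one]; rfl,
        by rw [compl_far hij.symm (fun e => ha e.symm), mul_one]; rfl⟩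
    | braid i j h =>
      have ha : Adj i j := Or.inl h
      exact Or.inr ⟨i, j, .of j * .of i, .of i * .of j, 1, rfl, rfl,
        by rw [compl_adj ha, mul_one]; rfl, by rw [compl_adj ha.symm, mul_one]; rfl⟩
  | refl w => exact refl w
  | symm h ih =>
    rcases ih (length_eq h ▸ hl) with ⟨h1, h2⟩ | ⟨i, j, x, y, z, h1, h2, h3, h4⟩
    · exact Or.inl ⟨h2, h1⟩
    · exact Or.inr ⟨j, i, y, x, z, h2, h1, h4, h3⟩
  | trans h1 h2 ih1 ih2 =>
    have hl' := length_eq h1 ▸ hl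
    rcases ih1 hl with ⟨rfl, rfl⟩ | ⟨i, k, x, u, z, rfl, rfl, hx, hu⟩
    · exact ih2 hl'
    rcases ih2 hl' with ⟨h, rfl⟩ | ⟨k', j, u', y, z', h, rfl, hu', hy⟩
    · simpa using congrArg FreeMonoid.length h
    · obtain ⟨rfl, rfl⟩ := cons_inj h
      refine Or.inr ⟨i, j, x, y, ?_⟩
      obtain ⟨w, h5, h6⟩ := H.trans (by rw [len_mk]; simpa [add_comm] using hl') hx hu hu' hy
      exact ⟨w, rfl, rfl, h5, h6⟩
  | @mul _ _ w' v' h1 h2 ih1 ih2 =>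
    rw [FreeMonoid.length_mul] at hl
    rcases ih1 (by omega) with ⟨rfl, rfl⟩ | ⟨i, j, x, y, z, rfl, rfl, hx, hy⟩
    · simpa using ih2 (by omega)
    · refine Or.inr ⟨i, j, _, _, z * .mk _ w', mul_assoc _ _ _, mul_assoc _ _ _,
        ?_, ?_⟩
      · rw [map_mul, hx, mul_assoc]
      · rw [map_mul, hy, mul_assoc, PresentedMonoid.mk_eq_mk_iff.2 h2]

theorem lcmUpTo (n m : ℕ) : LcmUpTo n m := by
  induction m with
  | zero => intro i j x y h; omega
  | succ m ih =>
    intro i j x y hl h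
    obtain ⟨x, rfl⟩ := PresentedMonoid.surjective_mk x
    obtain ⟨y, rfl⟩ := PresentedMonoid.surjective_mk y
    rw [len_mk] at hl
    have h' : ConGen.Rel (BraidRel n) (.of i * x) (.of j * y) := PresentedMonoid.mk_eq_mk_iff.1 h
    rcases ih.commonMultiple h' (by simpa [add_comm] using hl) with
      ⟨h, -⟩ | ⟨i', j', x', y', z, h1, h2, h3, h4⟩
    · simpa using congrArg FreeMonoid.length h
    · have e1 : i = i' ∧ x = x' := by simpa using congrArg FreeMonoid.toList h1
      have e2 : j = j' ∧ y = y' := by simpa using congrArg FreeMonoid.toList h2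
      obtain ⟨⟨rfl, rfl⟩, ⟨rfl, rfl⟩⟩ := And.intro e1 e2
      exact ⟨z, h3, h4⟩

theorem gen_mul_left_cancel {i : Fin (n - 1)} {x y : BraidMonoid n} (h : gen i * x = gen i * y) :
    x = y :=
  (lcmUpTo n (len x + 1)).cancel le_rfl h

/-- The braid monoid is left cancellative. -/
instance : IsLeftCancelMul (BraidMonoid n) where
  mul_left_cancel a x y h := by
    change a * x = a * y at h
    obtain ⟨a, rfl⟩ := PresentedMonoid.surjective_mk a
    induction a using FreeMonoid.inductionOn' with
    | one => simpa using h
    | of_mul i a ih =>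
      rw [map_mul, mul_assoc, mul_assoc] at h
      exact ih (gen_mul_left_cancel h)

end BraidMonoid

/-! ### The half turn -/

namespace BraidMonoid

variable {n : ℕ}

/-- The generator with a given index, and `1` if the index is out of range. -/
def natGen (n j : ℕ) : BraidMonoid n := if h : j < n - 1 then gen ⟨j, h⟩ else 1

theorem natGen_of_lt {j : ℕ} (h : j < n - 1) : natGen n j = gen ⟨j, h⟩ := dif_pos h

theorem natGen_comm {i j : ℕ} (h : i + 2 ≤ j) :
    natGen n i * natGen n j = natGen n j * natGen n i := by
  unfold natGen
  split_ifs
  · exact gen_comm (by unfold Adj; simp only; omega)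
  all_goals simp

theorem natGen_braid {j : ℕ} (h : j + 1 < n - 1) :
    natGen n j * natGen n (j + 1) * natGen n j =
      natGen n (j + 1) * natGen n j * natGen n (j + 1) := by
  rw [natGen_of_lt h, natGen_of_lt (by omega : j < n - 1)]
  exact gen_braid (Or.inl rfl)

/-- The product of the first `k` generators. -/
def ascending (n k : ℕ) : BraidMonoid n := ((List.range k).map (natGen n)).prod

@[simp] theorem ascending_zero : ascending n 0 = 1 := rfl

theorem ascending_succ (k : ℕ) : ascending n (k + 1) = ascending n k * natGen n k := by
  rw [ascending, List.prod_range_succ, ascending]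

theorem ascending_succ' (k : ℕ) :
    ∃ y, ascending n (k + 1) = natGen n 0 * y := by
  rw [ascending, List.prod_range_succ']
  exact ⟨_, rfl⟩

theorem natGen_mul_ascending {j m : ℕ} (h : j + 1 ≤ m) :
    natGen n m * ascending n j = ascending n j * natGen n m := by
  induction j with
  | zero => simp
  | succ j ih =>
    rw [ascending_succ, ← mul_assoc, ih (by omega), mul_assoc, mul_assoc, ← natGen_comm (by omega)]

/-- In the critical case `k = j + 2`, the last two factors and `σ_j` form a braid relation, and the
new `σ_{j+1}` commutes with everything to its left. -/
theorem ascending_mul_natGen {j k : ℕ} (h : j + 1 < k) (hk : k ≤ n - 1) :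
    ascending n k * natGen n j = natGen n (j + 1) * ascending n k := by
  induction k with
  | zero => omega
  | succ k ih =>
    rcases Nat.lt_or_ge (j + 1) k with hl | hl
    · rw [ascending_succ, mul_assoc, ← natGen_comm (by omega), ← mul_assoc, ih hl (by omega),
        mul_assoc]
    · obtain rfl : k = j + 1 := by omega
      rw [ascending_succ, ascending_succ, mul_assoc, mul_assoc, ← mul_assoc (natGen n j),
        natGen_braid (by omega), ← mul_assoc, ← mul_assoc, ← natGen_mul_ascending le_rfl]
      simp only [mul_assoc]

theorem natGen_zero_mul_ascending_mul_ascending {m k : ℕ} (h : m ≤ k) (hk : k + 1 ≤ n - 1) :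
    natGen n 0 * ascending n (k + 1) * ascending n m =
      ascending n (m + 1) * ascending n (k + 1) := by
  induction m with
  | zero => simp [ascending]
  | succ m ih =>
    rw [ascending_succ m, ← mul_assoc, ih (by omega), mul_assoc,
      ascending_mul_natGen (by omega) hk, ← mul_assoc, ← ascending_succ]

/-- The half turn of the first `k` strands. -/
def halfTurn (n : ℕ) : ℕ → BraidMonoid n
  | 0 => 1
  | k + 1 => ascending n k * halfTurn n k

theorem natGen_mul_halfTurn {j m : ℕ} (h : j ≤ m) :
    natGen n m * halfTurn n j = halfTurn n j * natGen n m := by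
  induction j with
  | zero => simp [halfTurn]
  | succ j ih =>
    rw [halfTurn, ← mul_assoc, natGen_mul_ascending h, mul_assoc, ih (by omega), mul_assoc]

/-- Each outer ascending factor raises the index of a generator that crosses it by one, which gives
the induction on `j'`. For `j' = 0` the generator is absorbed into the second ascending factor and
released as `σ_0` by the first. -/
theorem halfTurn_mul_natGen {j j' : ℕ} (h : j + j' + 2 ≤ n) :
    halfTurn n (j + j' + 2) * natGen n j = natGen n j' * halfTurn n (j + j' + 2) := by
  induction j' with
  | zero =>
    simp only [halfTurn]
    rw [← mul_assoc (natGen n 0), ← mul_assoc (natGen n 0 * _),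
      natGen_zero_mul_ascending_mul_ascending le_rfl (by omega), mul_assoc, mul_assoc,
      ← natGen_mul_halfTurn le_rfl, ← mul_assoc (ascending n j), ← ascending_succ, mul_assoc]
  | succ j' ih =>
    rw [show j + (j' + 1) + 2 = (j + j' + 2) + 1 by omega, halfTurn, mul_assoc, ih (by omega),
      ← mul_assoc, ascending_mul_natGen (by omega) (by omega), mul_assoc]

theorem exists_halfTurn_eq_natGen_mul {j k : ℕ} (h : j + 1 < k) (hk : k ≤ n) :
    ∃ y, halfTurn n k = natGen n j * y := by
  induction k generalizing j with
  | zero => omega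
  | succ k ih =>
    rw [halfTurn]
    rcases j with _ | j
    · obtain ⟨k, rfl⟩ : ∃ l, k = l + 1 := ⟨k - 1, by omega⟩
      obtain ⟨y, hy⟩ := ascending_succ' (n := n) k
      exact ⟨y * halfTurn n (k + 1), by rw [hy, mul_assoc]⟩
    · obtain ⟨y, hy⟩ := ih (j := j) (by omega) (by omega)
      exact ⟨ascending n k * y, by
        rw [hy, ← mul_assoc, ascending_mul_natGen (by omega) (by omega), mul_assoc]⟩

/-- The half turn. -/
def delta (n : ℕ) : BraidMonoid n := halfTurn n n

theorem delta_mul_gen (i : Fin (n - 1)) : delta n * gen i = gen i.rev * delta n := by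
  have h := halfTurn_mul_natGen (n := n) (j := i) (j' := i.rev) (by rw [Fin.val_rev]; omega)
  rwa [show (i : ℕ) + i.rev + 2 = n by rw [Fin.val_rev]; omega, natGen_of_lt i.isLt,
    natGen_of_lt i.rev.isLt] at h

theorem exists_delta_eq_gen_mul (i : Fin (n - 1)) : ∃ y, delta n = gen i * y := by
  have := exists_halfTurn_eq_natGen_mul (n := n) (j := i) (k := n) (by omega) le_rfl
  rwa [natGen_of_lt i.isLt] at this

theorem exists_delta_eq_mul_gen (i : Fin (n - 1)) : ∃ y, delta n = y * gen i := by
  obtain ⟨y, hy⟩ := exists_delta_eq_gen_mul i.rev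
  refine ⟨y, mul_left_cancel (a := gen i.rev) ?_⟩
  rw [← delta_mul_gen, ← mul_assoc, ← hy]

theorem delta_sq_mul (x : BraidMonoid n) : delta n ^ 2 * x = x * delta n ^ 2 := by
  obtain ⟨x, rfl⟩ := PresentedMonoid.surjective_mk x
  induction x using FreeMonoid.inductionOn' with
  | one => simp
  | of_mul i x ih =>
    have h : delta n ^ 2 * gen i = gen i * delta n ^ 2 := by
      rw [pow_two, mul_assoc, delta_mul_gen, ← mul_assoc, delta_mul_gen, Fin.rev_rev, mul_assoc]
    rw [map_mul, mul_assoc, ← ih, ← mul_assoc, ← mul_assoc]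
    exact congrArg (· * _) h

theorem len_ascending {k : ℕ} (hk : k ≤ n - 1) : len (ascending n k) = k := by
  induction k with
  | zero => simp [len]
  | succ k ih => rw [ascending_succ, len_mul, ih (by omega), natGen_of_lt (by omega), len_gen]

theorem len_halfTurn {k : ℕ} (hk : k ≤ n) : len (halfTurn n k) * 2 = k * (k - 1) := by
  induction k with
  | zero => simp [len, halfTurn]
  | succ k ih =>
    rw [halfTurn, len_mul, len_ascending (by omega), add_mul, ih (by omega)]
    rcases k with _ | k
    · rfl
    · simp only [Nat.add_sub_cancel]; ring

theorem len_delta : len (delta n) = n * (n - 1) / 2 := by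
  have := len_halfTurn (n := n) (k := n) le_rfl
  rw [delta]; omega

/-! ### The word `deltaWord` represents the half turn -/

theorem filter_lt_range {N k : ℕ} (h : k ≤ N) :
    (List.range N).filter (fun i => i < k) = List.range k := by
  induction N with
  | zero => obtain rfl : k = 0 := by omega
            rfl
  | succ N ih =>
    rcases Nat.lt_or_ge N k with hk | hk
    · obtain rfl : k = N + 1 := by omega
      rw [List.filter_eq_self]
      simp
    · rw [List.range_succ, List.filter_append, ih hk]
      simp [hk]

theorem prod_filter_finRange {k : ℕ} (h : k ≤ n - 1) :
    (((List.finRange (n - 1)).filter fun i => i.val < k).map gen).prod = ascending n k := by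
  have h1 : (gen : Fin (n - 1) → BraidMonoid n) = natGen n ∘ Fin.val := by
    funext i
    exact (natGen_of_lt i.isLt).symm
  rw [h1, ← List.map_map, ascending, ← filter_lt_range h, ← List.map_coe_finRange_eq_range,
    List.filter_map]
  rfl

theorem toMonoid_eq_prod (P : PosWord n) : P.toMonoid = (P.map gen).prod := by
  induction P with
  | nil => rfl
  | cons i P ih => rw [List.map_cons, List.prod_cons, ← ih]; rfl

theorem toMonoid_deltaWord : (deltaWord n).toMonoid = delta n := by
  have (m : ℕ) (hm : m ≤ n) : PosWord.toMonoid ((List.range m).reverse.flatMap fun k =>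
      (List.finRange (n - 1)).filter fun i => i.val < k) = halfTurn n m := by
    induction m with
    | zero => rfl
    | succ m ih =>
      rw [toMonoid_eq_prod] at ih ⊢
      rw [List.range_succ, List.reverse_append, List.reverse_singleton, List.singleton_append,
        List.flatMap_cons, List.map_append, List.prod_append, ih (by omega),
        prod_filter_finRange (by omega), halfTurn]
  exact this n le_rfl

theorem len_toMonoid (P : PosWord n) : len P.toMonoid = P.length := len_mk _

theorem exists_toMonoid_eq (x : BraidMonoid n) : ∃ P : PosWord n, P.toMonoid = x :=
  PresentedMonoid.surjective_mk x

/-! ### The embedding into the braid group -/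

/-- The canonical homomorphism from the braid monoid to the braid group. -/
def toBraidGroup (n : ℕ) : BraidMonoid n →* BraidGroup n :=
  PresentedMonoid.lift PresentedGroup.of (by
    intro u v h
    have h1 := PresentedGroup.one_of_mem (rels := braidRelators n) ⟨u, v, h, rfl⟩
    rw [map_mul, map_inv, mul_inv_eq_one] at h1
    have h2 (w : FreeMonoid (Fin (n - 1))) :
        FreeMonoid.lift (PresentedGroup.of (rels := braidRelators n)) w =
          PresentedGroup.mk (braidRelators n) (FreeMonoid.lift FreeGroup.of w) := by
      induction w using FreeMonoid.inductionOn' with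
      | one => rfl
      | of_mul i w ih => rw [map_mul, map_mul, map_mul, ih]; rfl
    rw [h2, h2, h1])

@[simp] theorem toBraidGroup_gen (i : Fin (n - 1)) :
    toBraidGroup n (gen i) = PresentedGroup.of i := rfl

theorem powers_delta_sq_comm (s : Submonoid.powers (delta n ^ 2)) (x : BraidMonoid n) :
    s * x = x * s := by
  obtain ⟨_, k, rfl⟩ := s
  exact Commute.pow_left (delta_sq_mul x : Commute _ _) k

/-- The powers of the full turn are central. -/
instance : OreLocalization.OreSet (Submonoid.powers (delta n ^ 2)) where
  ore_right_cancel r₁ r₂ s h :=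
    -- Centrality turns right multiplication by `s` into left multiplication, so right cancellation
    -- is not needed.
    ⟨s, by rw [powers_delta_sq_comm, powers_delta_sq_comm, h]⟩
  oreNum r _ := r
  oreDenom _ s := s
  ore_eq r s := powers_delta_sq_comm s r

/-- The localization of the braid monoid at the full turn. -/
abbrev Loc (n : ℕ) : Type := OreLocalization (Submonoid.powers (delta n ^ 2)) (BraidMonoid n)

/-- The canonical homomorphism to the localization. -/
def toLoc (n : ℕ) : BraidMonoid n →* Loc n := OreLocalization.numeratorHom

/-- Equality of fractions with denominator 1 holds after left multiplication by a common factor,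
which cancels. -/
theorem toLoc_injective : Function.Injective (toLoc n) := by
  intro a b h
  obtain ⟨u, v, h1, h2⟩ := OreLocalization.oreDiv_eq_iff.1 h
  simp only [OneMemClass.coe_one, mul_one] at h2
  rw [← h2] at h1
  exact (mul_left_cancel h1).symm

/-- A left and a right divisor of a unit has a right and a left inverse. -/
theorem isUnit_toLoc_gen (i : Fin (n - 1)) : IsUnit (toLoc n (gen i)) := by
  have hu : IsUnit (toLoc n (delta n)) := by
    have := OreLocalization.numerator_isUnit
      (⟨delta n ^ 2, 1, pow_one _⟩ : Submonoid.powers (delta n ^ 2))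
    change IsUnit (toLoc n (delta n ^ 2)) at this
    rwa [map_pow, isUnit_pow_iff two_ne_zero] at this
  obtain ⟨u, hu⟩ := hu
  obtain ⟨y, hy⟩ := exists_delta_eq_gen_mul i
  obtain ⟨z, hz⟩ := exists_delta_eq_mul_gen i
  refine isUnit_iff_exists_and_exists.2 ⟨⟨toLoc n y * ↑u⁻¹, ?_⟩, ⟨↑u⁻¹ * toLoc n z, ?_⟩⟩
  · rw [← mul_assoc, ← map_mul, ← hy, ← hu, Units.mul_inv]
  · rw [mul_assoc, ← map_mul, ← hz, ← hu, Units.inv_mul]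

/-- The homomorphism from the braid group to the units of the localization. -/
noncomputable def groupToLoc (n : ℕ) : BraidGroup n →* (Loc n)ˣ :=
  PresentedGroup.toGroup (f := fun i => (isUnit_toLoc_gen i).unit) (by
    rintro _ ⟨u, v, h, rfl⟩
    have h2 (w : FreeMonoid (Fin (n - 1))) :
        ((FreeGroup.lift (fun i => (isUnit_toLoc_gen i).unit)
          (FreeMonoid.lift FreeGroup.of w) : (Loc n)ˣ) : Loc n) =
            toLoc n (PresentedMonoid.mk _ w) := by
      induction w using FreeMonoid.inductionOn' with
      | one => simp
      | of_mul i w ih =>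
        rw [map_mul, map_mul, map_mul, map_mul, Units.val_mul, ih]
        congr 1
        simp [gen, PresentedMonoid.of]
    rw [map_mul, map_inv, mul_inv_eq_one]
    apply Units.ext
    rw [h2, h2, PresentedMonoid.mk_eq_mk_of_rel h])

theorem groupToLoc_toBraidGroup (x : BraidMonoid n) :
    (groupToLoc n (toBraidGroup n x) : Loc n) = toLoc n x := by
  obtain ⟨x, rfl⟩ := PresentedMonoid.surjective_mk x
  induction x using FreeMonoid.inductionOn' with
  | one => simp
  | of_mul i x ih =>
    rw [map_mul, map_mul, map_mul, map_mul, Units.val_mul, ih]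
    congr 1
    change ((groupToLoc n (PresentedGroup.of i) : (Loc n)ˣ) : Loc n) = toLoc n (gen i)
    simp [groupToLoc]

/-- Garside's theorem: the braid monoid embeds into the braid group. -/
theorem toBraidGroup_injective : Function.Injective (toBraidGroup n) := by
  intro a b h
  apply toLoc_injective
  rw [← groupToLoc_toBraidGroup, ← groupToLoc_toBraidGroup, h]

end BraidMonoid

/-! ### The division algorithm in the braid group -/

namespace StdWord

variable {n : ℕ}

@[simp] theorem toGroup_nil : StdWord.toGroup ([] : StdWord n) = 1 := rfl

@[simp] theorem toGroup_append (V W : StdWord n) :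
    StdWord.toGroup (V ++ W) = V.toGroup * W.toGroup := by
  rw [toGroup, toGroup, toGroup, ← map_mul, FreeGroup.mul_mk]

@[simp] theorem toGroup_inv (V : StdWord n) : V.inv.toGroup = V.toGroup⁻¹ := by
  rw [toGroup, toGroup, ← map_inv, FreeGroup.inv_mk]
  rfl

theorem toGroup_pos (i : Fin (n - 1)) :
    StdWord.toGroup [(i, true)] = BraidMonoid.toBraidGroup n (BraidMonoid.gen i) := rfl

theorem toGroup_neg (i : Fin (n - 1)) :
    StdWord.toGroup [(i, false)] = (BraidMonoid.toBraidGroup n (BraidMonoid.gen i))⁻¹ := by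
  rw [← toGroup_pos, ← toGroup_inv]
  rfl

end StdWord

theorem PosWord.toGroup_toStd {n : ℕ} (P : PosWord n) :
    P.toStd.toGroup = BraidMonoid.toBraidGroup n P.toMonoid := by
  induction P with
  | nil => rfl
  | cons i P ih =>
    change StdWord.toGroup ([(i, true)] ++ PosWord.toStd P) = _
    rw [StdWord.toGroup_append, ih, StdWord.toGroup_pos, ← map_mul]
    rfl

/-- By the embedding the defining equation may be read in the monoid, where comparing lengths makes
the length condition automatic. -/
theorem isDeltaQuotient_iff {n : ℕ} {D : Fin (n - 1) → PosWord n} :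
    IsDeltaQuotient n D ↔ ∀ i, (D i).toMonoid * BraidMonoid.gen i = BraidMonoid.delta n := by
  refine forall_congr' fun i => ?_
  rw [PosWord.toGroup_toStd, StdWord.toGroup_append, PosWord.toGroup_toStd, StdWord.toGroup_neg,
    eq_mul_inv_iff_mul_eq, ← map_mul, BraidMonoid.toBraidGroup_injective.eq_iff,
    BraidMonoid.toMonoid_deltaWord, and_iff_right_iff_imp]
  intro h
  have := congrArg BraidMonoid.len h
  rw [BraidMonoid.len_mul, BraidMonoid.len_gen, BraidMonoid.len_delta,
    BraidMonoid.len_toMonoid] at this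
  omega

theorem exists_isDeltaQuotient (n : ℕ) : ∃ D : Fin (n - 1) → PosWord n, IsDeltaQuotient n D := by
  choose y hy using BraidMonoid.exists_delta_eq_mul_gen (n := n)
  choose D hD using fun i => BraidMonoid.exists_toMonoid_eq (y i)
  exact ⟨D, isDeltaQuotient_iff.2 fun i => by rw [hD, hy i]⟩

/-! ### The exchange of neighbouring extended letters -/

namespace ExtLetter

variable {n : ℕ}

theorem shift_shift (d e : ZMod 4) (x : ExtLetter n) :
    (x.shift d).shift e = x.shift (d + e) := by
  obtain ⟨a, i, b⟩ := x
  simp only [shift, add_assoc, mk.injEq, true_and]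
  revert d e b
  decide

@[simp] theorem shift_zero (x : ExtLetter n) : x.shift 0 = x := by
  simp [shift]

theorem pos_shift_sub_one (d : ZMod 4) (x : ExtLetter n) :
    (x.shift (d - 1)).pos = !(x.shift d).pos := by
  obtain ⟨a, i, b⟩ := x
  simp only [shift]
  revert d b
  decide

/-- The element of the braid group that an extended letter represents. -/
def toGroup (D : Fin (n - 1) → PosWord n) (x : ExtLetter n) : BraidGroup n :=
  let g := (standardizeLetter D (x.a, x.idx)).toStd.toGroup
  if x.pos then g else g⁻¹

theorem toGroup_extend (D : Fin (n - 1) → PosWord n) (V : StdWord n) :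
    (V.extend.map (toGroup D)).prod = V.toGroup := by
  induction V with
  | nil => rfl
  | cons x V ih =>
    change toGroup D ⟨0, x.1, x.2⟩ * ((StdWord.extend V).map (toGroup D)).prod =
      StdWord.toGroup ([x] ++ V)
    rw [ih, StdWord.toGroup_append]
    congr 1
    obtain ⟨i, b⟩ := x
    cases b
    · exact (StdWord.toGroup_inv [(i, true)]).symm
    · rfl

theorem standardizeLetter_add_one {D : Fin (n - 1) → PosWord n} (hD : IsDeltaQuotient n D)
    (a : ZMod 4) (i : Fin (n - 1)) :
    (standardizeLetter D (a + 1, i)).toMonoid * (standardizeLetter D (a, i)).toMonoid =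
      BraidMonoid.delta n := by
  have h := isDeltaQuotient_iff.1 hD
  have h' (i : Fin (n - 1)) : BraidMonoid.gen i.rev * (D i).toMonoid = BraidMonoid.delta n := by
    -- In the group `σ_i` cancels on the right: `σ_{n-i} D_i σ_i = σ_{n-i} Δ = Δ σ_i`.
    apply BraidMonoid.toBraidGroup_injective
    apply mul_right_cancel (b := BraidMonoid.toBraidGroup n (BraidMonoid.gen i))
    rw [← map_mul, ← map_mul, mul_assoc, h, BraidMonoid.delta_mul_gen]
  have ha : a = 0 ∨ a = 1 ∨ a = 2 ∨ a = 3 := by revert a; decide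
  rcases ha with rfl | rfl | rfl | rfl
  · exact h i
  · exact h' i
  · exact h i.rev
  · have := h' i.rev
    rwa [Fin.rev_rev] at this

/-- A negative and a positive extended letter are exchanged. -/
theorem toGroup_mul_toGroup {D : Fin (n - 1) → PosWord n} (hD : IsDeltaQuotient n D)
    {x y : ExtLetter n} (hx : x.pos = false) (hy : y.pos = true) :
    x.toGroup D * y.toGroup D = (x.shift (-1)).toGroup D * (y.shift (-1)).toGroup D := by
  obtain ⟨a, i, _⟩ := x
  obtain ⟨b, j, _⟩ := y
  subst hx hy
  have h (a i) := congrArg (BraidMonoid.toBraidGroup n) (standardizeLetter_add_one hD (a - 1) i)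
  simp only [map_mul, sub_add_cancel] at h
  have hn : ¬ ((-1 : ZMod 4) = 0 ∨ (-1 : ZMod 4) = 2) := by decide
  simp only [toGroup, shift, hn, if_false, PosWord.toGroup_toStd, ← sub_eq_add_neg, Bool.not_false,
    Bool.not_true, if_true, Bool.false_eq_true]
  rw [inv_mul_eq_iff_eq_mul, ← mul_assoc, h, eq_mul_inv_iff_mul_eq, h]

/-- A positive extended letter moves to the left across a block of negative letters. -/
theorem prod_mul_toGroup {D : Fin (n - 1) → PosWord n} (hD : IsDeltaQuotient n D)
    {x : ExtLetter n} (hx : x.pos = true) (y : ExtLetter n) (N : List (ExtLetter n))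
    (hy : y.pos = false) (hN : ∀ z ∈ N, z.pos = false) :
    ((y :: N).map (toGroup D)).prod * x.toGroup D =
      (y.shift (-1)).toGroup D * ((N.map (shift (-2))).map (toGroup D)).prod *
        (x.shift (-1)).toGroup D := by
  induction N generalizing y with
  | nil => simp [toGroup_mul_toGroup hD hy hx]
  | cons z N ih =>
    have hz : z.pos = false := hN z (by simp)
    -- Once `x` has crossed the tail, `z` is positive and must itself cross `y`, which translates it
    -- a second time and restores its sign.
    have hz' : (z.shift (-1)).pos = true := by
      have := pos_shift_sub_one 0 z
      simpa [hz] using this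
    rw [List.map_cons, List.prod_cons, mul_assoc, ih z hz fun w hw => hN w (by simp [hw]),
      ← mul_assoc, ← mul_assoc, toGroup_mul_toGroup hD hy hz', shift_shift]
    simp only [List.map_cons, List.prod_cons, mul_assoc]
    rfl

end ExtLetter

/-! ### Correctness of the division -/

theorem separation_concat {n : ℕ} (W : List (ExtLetter n)) (x : ExtLetter n) :
    separation (W ++ [x]) = (separation W).append x.pos := by
  simp [separation]

/-- The bishift of a word by its separation represents the same braid, and consists of positive
letters followed by negative ones. -/
theorem exists_bishift_eq {n : ℕ} {D : Fin (n - 1) → PosWord n} (hD : IsDeltaQuotient n D)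
    (W : List (ExtLetter n)) :
    ∃ P N, bishift (separation W) W = P ++ N ∧ P.length = (separation W).L.length ∧
      (∀ x ∈ P, x.pos = true) ∧ (∀ x ∈ N, x.pos = false) ∧
      (P.map (ExtLetter.toGroup D)).prod * (N.map (ExtLetter.toGroup D)).prod =
        (W.map (ExtLetter.toGroup D)).prod := by
  -- Splitting `W` itself, before the shift, gives a statement that can be carried through an
  -- induction on the last letter.
  suffices h : ∃ W₁ W₂, W = W₁ ++ W₂ ∧ W₁.length = (separation W).L.length ∧
      W₂.length = (separation W).L'.length ∧
      (∀ x ∈ List.zipWith ExtLetter.shift (separation W).L W₁, x.pos = true) ∧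
      (∀ x ∈ List.zipWith ExtLetter.shift
        ((separation W).L'.map fun d => (separation W).δ + d) W₂, x.pos = false) ∧
      ((List.zipWith ExtLetter.shift (separation W).L W₁).map (ExtLetter.toGroup D)).prod *
        ((List.zipWith ExtLetter.shift
          ((separation W).L'.map fun d => (separation W).δ + d) W₂).map
            (ExtLetter.toGroup D)).prod =
        (W.map (ExtLetter.toGroup D)).prod by
    obtain ⟨W₁, W₂, hW, h1, h2, h3, h4, h5⟩ := h
    refine ⟨_, _, ?_, ?_, h3, h4, h5⟩
    · rw [bishift]
      conv_lhs => rw [hW]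
      rw [List.zipWith_append (by rw [← hW, h1])]
      rw [← hW]
    · simp [h1]
  induction W using List.reverseRecOn with
  | nil => exact ⟨[], [], by simp [separation]⟩
  | append_singleton W x ih =>
    obtain ⟨W₁, W₂, hW, h1, h2, h3, h4, h5⟩ := ih
    rw [separation_concat]
    generalize separation W = t at *
    obtain ⟨L, δ, L'⟩ := t
    dsimp only at h1 h2 h3 h4 h5
    rw [List.map_append, List.prod_append, ← h5, List.map_singleton, List.prod_singleton]
    rcases hx : x.pos with _ | _
    · refine ⟨W₁, W₂ ++ [x], by simp [hW], h1, by simp [Trip.append, h2], h3, ?_, ?_⟩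
      · simp only [Trip.append, List.map_append, List.map_singleton]
        rw [List.zipWith_append (by simp [h2])]
        simpa [or_imp, forall_and, hx] using h4
      · simp only [Trip.append, List.map_append, List.map_singleton]
        rw [List.zipWith_append (by simp [h2])]
        simp [mul_assoc]
    · rcases L' with _ | ⟨a, L'⟩
      · obtain rfl : W₂ = [] := List.eq_nil_of_length_eq_zero h2
        refine ⟨W₁ ++ [x], [], by simp [hW], by simp [Trip.append, h1], rfl, ?_,
          by simp [Trip.append], ?_⟩
        · simp only [Trip.append]
          rw [List.zipWith_append h1.symm]
          simpa [or_imp, forall_and, hx] using h3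
        · simp only [Trip.append]
          rw [List.zipWith_append h1.symm]
          simp
      · obtain _ | ⟨y, W₂⟩ := W₂
        · simp at h2
        simp only [List.length_cons, add_left_inj] at h2
        simp only [List.map_cons, List.zipWith_cons_cons, List.mem_cons, forall_eq_or_imp] at h4
        -- Adding 2 to `δ` translates all remaining negative letters at once; the required
        -- translation is `-2`, which equals 2 modulo 4.
        have hs : List.zipWith ExtLetter.shift (L'.map fun d => δ + 2 + d) W₂ =
            (List.zipWith ExtLetter.shift (L'.map fun d => δ + d) W₂).map
              (ExtLetter.shift (-2)) := by
          rw [List.map_zipWith, List.zipWith_map_left, List.zipWith_map_left]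
          congr 1
          funext d z
          rw [ExtLetter.shift_shift]
          congr 1
          have : (2 : ZMod 4) = -2 := by decide
          linear_combination this
        -- The entry `1 - δ` compensates the new offset `δ + 2`, leaving the shift `-1` for `x`.
        have e1 : δ + 2 + (1 - δ) = (-1 : ZMod 4) := by
          have : (2 : ZMod 4) + 1 = -1 := by decide
          linear_combination this
        have e2 : y.shift (a + δ - 1) = (y.shift (δ + a)).shift (-1) := by
          rw [ExtLetter.shift_shift]; congr 1; ring
        have hx' : (x.shift (-1)).pos = false := by
          simpa [hx] using ExtLetter.pos_shift_sub_one 0 x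
        have hy' : (y.shift (a + δ - 1)).pos = true := by
          rw [ExtLetter.pos_shift_sub_one, add_comm, h4.1]; rfl
        refine ⟨W₁ ++ [y], W₂ ++ [x], by simp [hW], by simp [Trip.append, h1],
          by simp [Trip.append, h2], ?_, ?_, ?_⟩
        · simp only [Trip.append]
          rw [List.zipWith_append h1.symm]
          simpa [or_imp, forall_and, hy'] using h3
        · simp only [Trip.append, List.map_append, List.map_singleton]
          rw [List.zipWith_append (by simp [h2]), hs]
          simp only [List.mem_append, List.mem_map, or_imp, forall_and]
          refine ⟨?_, by simpa [e1] using hx'⟩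
          rintro _ ⟨z, hz, rfl⟩
          have h6 := ExtLetter.pos_shift_sub_one 0 z
          have h7 := ExtLetter.pos_shift_sub_one (-1) z
          have e3 : (-1 - 1 : ZMod 4) = -2 := by decide
          rw [e3] at h7
          simp only [zero_sub, ExtLetter.shift_zero] at h6
          rw [h7, h6, h4.2 z hz]; rfl
        · simp only [Trip.append, List.map_append, List.map_cons, List.map_nil]
          rw [List.zipWith_append h1.symm, List.zipWith_append (by simp [h2]), hs, mul_assoc,
            show List.zipWith ExtLetter.shift ((δ + a) :: L'.map fun d => δ + d) (y :: W₂) =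
              y.shift (δ + a) :: List.zipWith ExtLetter.shift (L'.map fun d => δ + d) W₂ from rfl,
            ExtLetter.prod_mul_toGroup hD hx _ _ h4.1 h4.2]
          simp [e1, e2, mul_assoc]

theorem toGroup_standardize {n : ℕ} {D : Fin (n - 1) → PosWord n} (W : List (PosExtLetter n)) :
    (standardize D W).toStd.toGroup =
      (W.map fun x => (standardizeLetter D x).toStd.toGroup).prod := by
  induction W with
  | nil => rfl
  | cons x W ih =>
    rw [List.map_cons, List.prod_cons, ← ih, ← StdWord.toGroup_append]
    simp [standardize, PosWord.toStd]

/-- A word represents the same braid as its fixed standard division. -/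
theorem toGroup_stdDivision {n : ℕ} {D : Fin (n - 1) → PosWord n} (hD : IsDeltaQuotient n D)
    (V : StdWord n) :
    StdWord.toGroup ((stdDivision D V).1.toStd ++ (stdDivision D V).2.toStd.inv) = V.toGroup := by
  obtain ⟨P, N, h1, h2, h3, h4, h5⟩ := exists_bishift_eq hD V.extend
  rw [ExtLetter.toGroup_extend] at h5
  rw [StdWord.toGroup_append, StdWord.toGroup_inv, ← h5]
  simp only [stdDivision, extDivision, toGroup_standardize, h1, List.map_append]
  rw [List.take_left' (by simpa using h2), List.drop_left' (by simpa using h2)]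
  congr 1
  · rw [List.map_map]
    congr 1
    refine List.map_congr_left fun x hx => ?_
    simp [ExtLetter.toGroup, h3 x hx]
  · rw [List.map_reverse, List.prod_reverse_noncomm, inv_inv, List.map_map, List.map_map]
    congr 1
    refine List.map_congr_left fun x hx => ?_
    simp [ExtLetter.toGroup, h4 x hx]

theorem mem_groupWordProblem_iff {n : ℕ} {D : Fin (n - 1) → PosWord n} (hD : IsDeltaQuotient n D)
    (w : StdWord n × StdWord n) :
    w ∈ groupWordProblem n ↔ stdDivision D (w.1 ++ w.2.inv) ∈ monoidWordProblem n := by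
  have h := toGroup_stdDivision hD (w.1 ++ w.2.inv)
  simp only [StdWord.toGroup_append, StdWord.toGroup_inv, PosWord.toGroup_toStd] at h
  change w.1.toGroup = w.2.toGroup ↔ PosWord.toMonoid _ = PosWord.toMonoid _
  rw [← mul_inv_eq_one, ← h, mul_inv_eq_one, BraidMonoid.toBraidGroup_injective.eq_iff]

/-! ### Stack programs -/

section StackProgram

open Turing

variable {K : Type} [DecidableEq K] {Γ : K → Type} {Λ : Type}

/-- The instructions of a program that works on finitely many stacks. -/
inductive StackInstr (Γ : K → Type) (Λ : Type)
  | read (k : K) (next : Option (Γ k) → Λ)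
  | write (k : K) (w : List (Γ k)) (rest : StackInstr Γ Λ)
  | goto (l : Λ)
  | halt

namespace StackInstr

/-- The effect of an instruction. -/
def exec : StackInstr Γ Λ → (∀ k, List (Γ k)) → Option Λ × (∀ k, List (Γ k))
  | read k next, S => (some (next (S k).head?), Function.update S k (S k).tail)
  | write k w rest, S => rest.exec (Function.update S k (w ++ S k))
  | goto l, S => (some l, S)
  | halt, S => (none, S)

/-- The statement that pushes a word. -/
def pushWord (k : K) : List (Γ k) → TM2.Stmt Γ Λ (Option (Σ k, Γ k)) →
    TM2.Stmt Γ Λ (Option (Σ k, Γ k))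
  | [], q => q
  -- The tail is pushed before the head, so that the first letter ends on top.
  | x :: w, q => pushWord k w (.push k (fun _ => x) q)

theorem stepAux_pushWord (k : K) (w : List (Γ k)) (q : TM2.Stmt Γ Λ (Option (Σ k, Γ k)))
    (v : Option (Σ k, Γ k)) (S : ∀ k, List (Γ k)) :
    TM2.stepAux (pushWord k w q) v S = TM2.stepAux q v (Function.update S k (w ++ S k)) := by
  induction w generalizing q with
  | nil => simp [pushWord]
  | cons x w ih => simp [pushWord, ih]

/-- The symbol that was read from the stack `k`. -/
def lastRead (k : K) : Option (Σ k, Γ k) → Option (Γ k)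
  | none => none
  | some ⟨k', x⟩ => if h : k' = k then some (h ▸ x) else none

theorem lastRead_map (k : K) (o : Option (Γ k)) : lastRead k (o.map (Sigma.mk k)) = o := by
  cases o <;> simp [lastRead]

/-- The statement of a multi-stack machine that performs an instruction. -/
def toStmt : StackInstr Γ Λ → TM2.Stmt Γ Λ (Option (Σ k, Γ k))
  | read k next => .pop k (fun _ o => o.map (Sigma.mk k)) (.goto fun v => next (lastRead k v))
  | write k w rest => pushWord k w rest.toStmt
  | goto l => .goto fun _ => l
  -- A final configuration must have the initial internal state, so the last symbol read is erased.
  | halt => .load (fun _ => none) .halt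

theorem exists_stepAux_toStmt (q : StackInstr Γ Λ) (v : Option (Σ k, Γ k))
    (S : ∀ k, List (Γ k)) :
    ∃ v', TM2.stepAux q.toStmt v S = ⟨(q.exec S).1, v', (q.exec S).2⟩ ∧
      ((q.exec S).1 = none → v' = none) := by
  induction q generalizing S with
  | read k next =>
    exact ⟨_, by simp only [toStmt, TM2.stepAux, exec, lastRead_map]; rfl, by simp [exec]⟩
  | write k w rest ih =>
    rw [toStmt, stepAux_pushWord]
    exact ih _
  | goto l => exact ⟨v, rfl, by simp [exec]⟩
  | halt => exact ⟨none, rfl, fun _ => rfl⟩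

/-- `Run prog t c c'`: the program leads from `c` to `c'` in at most `t` steps. -/
inductive Run (prog : Λ → StackInstr Γ Λ) : ℕ → Option Λ × (∀ k, List (Γ k)) →
    Option Λ × (∀ k, List (Γ k)) → Prop
  | refl (t c) : Run prog t c c
  | step {t l S c} : Run prog t ((prog l).exec S) c → Run prog (t + 1) (some l, S) c

theorem Run.mono {prog : Λ → StackInstr Γ Λ} {t t' c c'} (h : Run prog t c c') (ht : t ≤ t') :
    Run prog t' c c' := by
  induction h generalizing t' with
  | refl t c => exact .refl _ _
  | step h ih =>
    obtain ⟨t', rfl⟩ : ∃ s, t' = s + 1 := ⟨t' - 1, by omega⟩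
    exact .step (ih (by omega))

theorem Run.trans {prog : Λ → StackInstr Γ Λ} {t t' c c' c''} (h : Run prog t c c')
    (h' : Run prog t' c' c'') : Run prog (t + t') c c'' := by
  induction h with
  | refl t c => exact h'.mono (by omega)
  | step h ih =>
    rw [add_right_comm]
    exact .step (ih h')

/-- The multi-stack machine of a program. -/
def toFinTM2 [Fintype K] [∀ k, Fintype (Γ k)] [Fintype Λ] (prog : Λ → StackInstr Γ Λ)
    (main : Λ) (k₀ k₁ : K) : FinTM2 where
  K := K
  k₀ := k₀
  k₁ := k₁
  Γ := Γ
  Λ := Λ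
  main := main
  σ := Option (Σ k, Γ k)
  initialState := none
  m l := (prog l).toStmt

theorem Run.exists_iterate [Fintype K] [∀ k, Fintype (Γ k)] [Fintype Λ]
    {prog : Λ → StackInstr Γ Λ} {main : Λ} {k₀ k₁ : K} {t : ℕ}
    {c c' : Option Λ × (∀ k, List (Γ k))} (h : Run prog t c c') (hc' : c'.1 = none)
    (v : Option (Σ k, Γ k)) (hv : c.1 = none → v = none) :
    ∃ s ≤ t, (flip bind (toFinTM2 prog main k₀ k₁).step)^[s]
      (some (⟨c.1, v, c.2⟩ : TM2.Cfg Γ Λ (Option (Σ k, Γ k)))) =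
        some (⟨none, none, c'.2⟩ : TM2.Cfg Γ Λ (Option (Σ k, Γ k))) := by
  induction h generalizing v with
  | refl t c => exact ⟨0, by omega, by rw [hv hc', ← hc']; rfl⟩
  | @step t l S c h ih =>
    obtain ⟨v', h1, h2⟩ := exists_stepAux_toStmt (prog l) v S
    obtain ⟨s, hs, h3⟩ := ih hc' v' h2
    refine ⟨s + 1, by omega, ?_⟩
    rw [Function.iterate_succ_apply, ← h3]
    congr 1
    exact congrArg some h1

/-- A program that always halts in linear time computes a function in linear time. -/
theorem computableInLinearTime [Fintype K] [∀ k, Fintype (Γ k)] [Fintype Λ]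
    {α β A B : Type} {ea : α → List A} {eb : β → List B} {f : α → β}
    (prog : Λ → StackInstr Γ Λ) (main : Λ) (k₀ k₁ : K) (e₀ : Γ k₀ ≃ A) (e₁ : Γ k₁ ≃ B) (c : ℕ)
    (h : ∀ x, Run prog (c * ((ea x).length + 1))
      (some main, Function.update (fun _ => []) k₀ ((ea x).map e₀.symm))
      (none, Function.update (fun _ => []) k₁ ((eb (f x)).map e₁.symm))) :
    ComputableInLinearTime ea eb f := by
  have key (x : α) : Nonempty (TM2OutputsInTime (toFinTM2 prog main k₀ k₁)
      ((ea x).map e₀.symm) (some ((eb (f x)).map e₁.symm)) (c * ((ea x).length + 1))) := by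
    obtain ⟨s, hs, h1⟩ := (h x).exists_iterate (main := main) (k₀ := k₀) (k₁ := k₁) rfl none
      (by simp)
    refine ⟨⟨⟨s, ?_⟩, hs⟩⟩
    -- This is the form in which initial and final stacks of a machine are defined.
    have upd (k : K) (w : List (Γ k)) : (Function.update (fun _ => []) k w : ∀ k, List (Γ k)) =
        fun k' => @dite (List (Γ k')) (k' = k) _ (fun h => by rw [h]; exact w) fun _ => [] := by
      funext k'
      by_cases hk : k' = k
      · subst hk; simp
      · simp [hk]
    rw [upd, upd] at h1
    exact h1
  exact ⟨{
    tm := toFinTM2 prog main k₀ k₁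
    inputAlphabet := e₀
    outputAlphabet := e₁
    time := fun m => c * (m + 1)
    outputsFun := fun x => (key x).some }, fun (k : K) => Finite.of_fintype (Γ k),
    c, fun m => le_rfl⟩

end StackInstr

end StackProgram

/-! ### Division in linear time -/

namespace LinearDivision

variable {n : ℕ}

/-- The state of a left-to-right scan that computes separations: whether a negative letter was
seen, the current `δ`, and two stacks with the last entry on top. Every letter `σ_i^{±1}` leaves
the entry `(i, t)` on `A`, where `t` would enter the list `L'` of the separation, and every
positive letter leaves the current `δ` on `B`. -/
structure Scan (n : ℕ) where
  ctl : Bool × ZMod 4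
  A : List (Fin (n - 1) × ZMod 4)
  B : List (ZMod 4)

/-- The entry of a letter on the stack `A`. -/
def entry (s : Bool × ZMod 4) (x : Fin (n - 1) × Bool) : Fin (n - 1) × ZMod 4 :=
  (x.1, if x.2 then 1 - s.2 else -s.2)

/-- The entries of a letter on the stack `B`. -/
def record (s : Bool × ZMod 4) (x : Fin (n - 1) × Bool) : List (ZMod 4) :=
  if x.2 then [s.2] else []

/-- The transition of the finite control. -/
def nextCtl (s : Bool × ZMod 4) (x : Fin (n - 1) × Bool) : Bool × ZMod 4 :=
  if x.2 then (s.1, if s.1 then s.2 + 2 else s.2) else (true, s.2)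

/-- The effect of a letter on the scan. -/
def Scan.push (T : Scan n) (x : Fin (n - 1) × Bool) : Scan n :=
  ⟨nextCtl T.ctl x, entry T.ctl x :: T.A, record T.ctl x ++ T.B⟩

/-- The scan of a standard word. -/
def scan (V : StdWord n) : Scan n := V.foldl Scan.push ⟨(false, 0), [], []⟩

/-- The extended letter of an entry of `A` whose separation entry was completed with `d`. -/
def finishLeft (y : Fin (n - 1) × ZMod 4) (d : ZMod 4) : PosExtLetter n := (y.2 + d - 1, y.1)

/-- The extended letter of an entry of `A` that stays to the right. -/
def finishRight (δ : ZMod 4) (y : Fin (n - 1) × ZMod 4) : PosExtLetter n := (δ + y.2, y.1)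

theorem scan_concat (V : StdWord n) (x : Fin (n - 1) × Bool) :
    scan (V ++ [x]) = (scan V).push x := by
  simp [scan]

/-- `A₁` holds the entries already removed from the queue and `A₂` those still in it. The queue
never shrinks, so it is empty exactly until the first negative letter; this is the Boolean of the
control. -/
theorem exists_separation_eq (V : StdWord n) :
    ∃ A₁ A₂, (scan V).A.reverse = A₁ ++ A₂ ∧ A₁.length = (scan V).B.length ∧
      (scan V).A.reverse.map Prod.fst = V.map Prod.fst ∧
      (scan V).ctl.1 = !A₂.isEmpty ∧ (A₂ = [] → (scan V).ctl.2 = 0) ∧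
      separation (StdWord.extend V) =
        ⟨List.zipWith (fun y d => y.2 + d - 1) A₁ (scan V).B.reverse, (scan V).ctl.2,
          A₂.map Prod.snd⟩ := by
  induction V using List.reverseRecOn with
  | nil => exact ⟨[], [], by simp [scan, separation, StdWord.extend]⟩
  | append_singleton V x ih =>
    obtain ⟨A₁, A₂, h1, h2, h3, h4, h5, h6⟩ := ih
    rw [scan_concat, show StdWord.extend (V ++ [x]) = StdWord.extend V ++ [⟨0, x.1, x.2⟩] by
      simp [StdWord.extend], separation_concat, h6]
    generalize scan V = T at *
    obtain ⟨⟨s, δ⟩, A, B⟩ := T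
    obtain ⟨i, b⟩ := x
    dsimp only at h1 h2 h3 h4 h5
    have hz (y : Fin (n - 1) × ZMod 4) (d : ZMod 4) :
        List.zipWith (fun y d => y.2 + d - 1) (A₁ ++ [y]) (B.reverse ++ [d]) =
          List.zipWith (fun y d => y.2 + d - 1) A₁ B.reverse ++ [y.2 + d - 1] :=
      List.zipWith_append (by simpa using h2)
    have hf (l : List (Fin (n - 1))) : A₁.map Prod.fst ++ (A₂.map Prod.fst ++ l) =
        V.map Prod.fst ++ l := by
      rw [← h3, h1, List.map_append, List.append_assoc]
    cases b
    · refine ⟨A₁, A₂ ++ [(i, -δ)], ?_, ?_, ?_, ?_, ?_, ?_⟩ <;>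
        simp_all [Scan.push, entry, record, nextCtl, Trip.append]
    · rcases A₂ with _ | ⟨a, A₂⟩
      · refine ⟨A₁ ++ [(i, 1 - δ)], [], ?_, ?_, ?_, ?_, ?_, ?_⟩ <;>
          simp_all [Scan.push, entry, record, nextCtl, Trip.append]
      · refine ⟨A₁ ++ [a], A₂ ++ [(i, 1 - δ)], ?_, ?_, ?_, ?_, ?_, ?_⟩ <;>
          simp_all [Scan.push, entry, record, nextCtl, Trip.append]

theorem exists_extDivision_eq (V : StdWord n) :
    ∃ A₁ A₂, (scan V).A.reverse = A₁ ++ A₂ ∧ A₁.length = (scan V).B.length ∧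
      extDivision (StdWord.extend V) = (List.zipWith finishLeft A₁ (scan V).B.reverse,
        (A₂.map (finishRight (scan V).ctl.2)).reverse) := by
  obtain ⟨A₁, A₂, h1, h2, h3, -, -, h6⟩ := exists_separation_eq V
  refine ⟨A₁, A₂, h1, h2, ?_⟩
  have hb (d : List (ZMod 4)) : (List.zipWith ExtLetter.shift d (StdWord.extend V)).map
      (fun x => (x.a, x.idx)) = List.zip d (V.map Prod.fst) := by
    rw [StdWord.extend, List.zipWith_map_right, List.map_zipWith, List.zip, List.zipWith_map_right]
    simp [ExtLetter.shift]
  simp only [extDivision, bishift, hb]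
  rw [h6, ← h3, h1]
  dsimp only
  rw [List.map_append, List.zip_append (by simp [h2]), List.take_left' (by simp [h2]),
    List.drop_left' (by simp [h2])]
  congr 2
  · rw [List.zip, List.zipWith_map_right]
    generalize (scan V).B.reverse = B
    clear h1 h2 h3 h6
    induction A₁ generalizing B with
    | nil => simp
    | cons a A₁ ih =>
      cases B with
      | nil => simp
      | cons d B => simp [finishLeft, ih]
  · rw [List.map_map, List.zip_map']
    rfl

/-- The stacks of the machine. -/
inductive Stack
  | input | word | scanA | scanB | queueA | queueB | left | output
  deriving DecidableEq

instance : Fintype Stack where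
  elems := {.input, .word, .scanA, .scanB, .queueA, .queueB, .left, .output}
  complete k := by cases k <;> decide

/-- The alphabets of the stacks. -/
abbrev Alphabet (n : ℕ) : Stack → Type
  | .input => Option (Fin (n - 1) × Bool)
  | .word => Fin (n - 1) × Bool
  | .scanA => Fin (n - 1) × ZMod 4
  | .scanB => ZMod 4
  | .queueA => Fin (n - 1) × ZMod 4
  | .queueB => ZMod 4
  | .left => PosExtLetter n
  | .output => Option (Fin (n - 1))

instance : ∀ k, Fintype (Alphabet n k)
  | .input => inferInstanceAs (Fintype (Option (Fin (n - 1) × Bool)))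
  | .word => inferInstanceAs (Fintype (Fin (n - 1) × Bool))
  | .scanA => inferInstanceAs (Fintype (Fin (n - 1) × ZMod 4))
  | .scanB => inferInstanceAs (Fintype (ZMod 4))
  | .queueA => inferInstanceAs (Fintype (Fin (n - 1) × ZMod 4))
  | .queueB => inferInstanceAs (Fintype (ZMod 4))
  | .left => inferInstanceAs (Fintype (ZMod 4 × Fin (n - 1)))
  | .output => inferInstanceAs (Fintype (Option (Fin (n - 1))))

/-- The labels of the program. -/
inductive Label (n : ℕ)
  | readX (s : Bool × ZMod 4)
  | scanX (s : Bool × ZMod 4) (x : Fin (n - 1) × Bool)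
  | readY (s : Bool × ZMod 4)
  | storeY (s : Bool × ZMod 4) (x : Fin (n - 1) × Bool)
  | readW (s : Bool × ZMod 4)
  | scanW (s : Bool × ZMod 4) (x : Fin (n - 1) × Bool)
  | readA (δ : ZMod 4)
  | storeA (δ : ZMod 4) (y : Fin (n - 1) × ZMod 4)
  | readB (δ : ZMod 4)
  | storeB (δ d : ZMod 4)
  | readLeft (δ : ZMod 4)
  | readLeft' (δ d : ZMod 4)
  | storeLeft (δ : ZMod 4) (z : ZMod 4 × Fin (n - 1))
  | readRight (δ : ZMod 4)
  | emitRight (δ : ZMod 4) (z : ZMod 4 × Fin (n - 1))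
  | separator
  | readOut
  | emitLeft (z : ZMod 4 × Fin (n - 1))
  | finish
  deriving Fintype

open StackInstr

/-- The program that computes fixed standard divisions. -/
def prog (D : Fin (n - 1) → PosWord n) : Label n → StackInstr (Alphabet n) (Label n)
  | .readX s => read .input fun
    | some (some x) => .scanX s x
    | some none => .readY s
    | none => .finish
  | .scanX s x => write .scanA [entry s x] (write .scanB (record s x) (goto (.readX (nextCtl s x))))
  | .readY s => read .input fun
    | some (some x) => .storeY s x
    | some none => .finish
    | none => .readW s
  | .storeY s x => write .word [(x.1, !x.2)] (goto (.readY s))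
  | .readW s => read .word fun
    | some x => .scanW s x
    | none => .readA s.2
  | .scanW s x => write .scanA [entry s x] (write .scanB (record s x) (goto (.readW (nextCtl s x))))
  | .readA δ => read .scanA fun
    | some y => .storeA δ y
    | none => .readB δ
  | .storeA δ y => write .queueA [y] (goto (.readA δ))
  | .readB δ => read .scanB fun
    | some d => .storeB δ d
    | none => .readLeft δ
  | .storeB δ d => write .queueB [d] (goto (.readB δ))
  | .readLeft δ => read .queueB fun
    | some d => .readLeft' δ d
    | none => .readRight δ
  -- The failure branch is never reached: `queueA` has at least as many entries as `queueB`.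
  | .readLeft' δ d => read .queueA fun
    | some y => .storeLeft δ (finishLeft y d)
    | none => .finish
  -- The output is filled from its bottom, so `P` must be emitted backwards; the stack `left`
  -- reverses it. The reversal in `Q` comes from the output stack itself.
  | .storeLeft δ z => write .left [z] (goto (.readLeft δ))
  | .readRight δ => read .queueA fun
    | some y => .emitRight δ (finishRight δ y)
    | none => .separator
  | .emitRight δ z => write .output ((standardizeLetter D z).map some) (goto (.readRight δ))
  | .separator => write .output [none] (goto .readOut)
  | .readOut => read .left fun
    | some z => .emitLeft z
    | none => .finish
  | .emitLeft z => write .output ((standardizeLetter D z).map some) (goto .readOut)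
  | .finish => halt

/-- The family of stacks with given contents. -/
def tapes (i : List (Option (Fin (n - 1) × Bool))) (w : List (Fin (n - 1) × Bool))
    (a : List (Fin (n - 1) × ZMod 4)) (b : List (ZMod 4)) (a' : List (Fin (n - 1) × ZMod 4))
    (b' : List (ZMod 4)) (l : List (PosExtLetter n)) (o : List (Option (Fin (n - 1)))) :
    ∀ k, List (Alphabet n k)
  | .input => i
  | .word => w
  | .scanA => a
  | .scanB => b
  | .queueA => a'
  | .queueB => b'
  | .left => l
  | .output => o

/-! ### Runs of the loops of the program -/

section

variable (i : List (Option (Fin (n - 1) × Bool))) (w : List (Fin (n - 1) × Bool))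
    (a : List (Fin (n - 1) × ZMod 4)) (b : List (ZMod 4)) (a' : List (Fin (n - 1) × ZMod 4))
    (b' : List (ZMod 4)) (l : List (PosExtLetter n)) (o : List (Option (Fin (n - 1))))

theorem update_input (v) : Function.update (tapes i w a b a' b' l o) .input v =
    tapes v w a b a' b' l o := by
  funext k; cases k <;> rfl

theorem update_word (v) : Function.update (tapes i w a b a' b' l o) .word v =
    tapes i v a b a' b' l o := by
  funext k; cases k <;> rfl

theorem update_scanA (v) : Function.update (tapes i w a b a' b' l o) .scanA v =
    tapes i w v b a' b' l o := by
  funext k; cases k <;> rfl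

theorem update_scanB (v) : Function.update (tapes i w a b a' b' l o) .scanB v =
    tapes i w a v a' b' l o := by
  funext k; cases k <;> rfl

theorem update_queueA (v) : Function.update (tapes i w a b a' b' l o) .queueA v =
    tapes i w a b v b' l o := by
  funext k; cases k <;> rfl

theorem update_queueB (v) : Function.update (tapes i w a b a' b' l o) .queueB v =
    tapes i w a b a' v l o := by
  funext k; cases k <;> rfl

theorem update_left (v) : Function.update (tapes i w a b a' b' l o) .left v =
    tapes i w a b a' b' v o := by
  funext k; cases k <;> rfl

theorem update_output (v) : Function.update (tapes i w a b a' b' l o) .output v =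
    tapes i w a b a' b' l v := by
  funext k; cases k <;> rfl

variable (D : Fin (n - 1) → PosWord n)

set_option linter.unusedSimpArgs false

theorem run_readX (X : StdWord n) (T : Scan n) :
    Run (prog D) (2 * X.length + 1)
      (some (.readX T.ctl), tapes (X.map some ++ none :: i) w T.A T.B a' b' l o)
      (some (.readY (X.foldl Scan.push T).ctl),
        tapes i w (X.foldl Scan.push T).A (X.foldl Scan.push T).B a' b' l o) := by
  induction X generalizing T with
  | nil =>
    refine .step ?_
    simp only [prog, exec, update_input, tapes, List.map_nil, List.map_cons,
      List.nil_append, List.cons_append, List.head?_nil, List.head?_cons, List.tail_nil, List.tail_cons]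
    exact .refl _ _
  | cons x X ih =>
    refine .step ?_
    simp only [prog, exec, update_input, tapes, List.map_nil, List.map_cons,
      List.nil_append, List.cons_append, List.head?_nil, List.head?_cons, List.tail_nil, List.tail_cons]
    refine .step ?_
    simp only [prog, exec, update_scanA, update_scanB, tapes, List.map_nil, List.map_cons,
      List.nil_append, List.cons_append, List.head?_nil, List.head?_cons, List.tail_nil, List.tail_cons]
    exact ih (T.push x)

theorem run_readY (Y : StdWord n) (s : Bool × ZMod 4) :
    Run (prog D) (2 * Y.length + 1)
      (some (.readY s), tapes (Y.map some) w a b a' b' l o)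
      (some (.readW s), tapes [] (StdWord.inv Y ++ w) a b a' b' l o) := by
  induction Y generalizing w with
  | nil =>
    refine .step ?_
    simp only [prog, exec, update_input, tapes, List.map_nil, List.map_cons,
      List.nil_append, List.cons_append, List.head?_nil, List.head?_cons, List.tail_nil, List.tail_cons]
    exact .refl _ _
  | cons x Y ih =>
    refine .step ?_
    simp only [prog, exec, update_input, tapes, List.map_nil, List.map_cons,
      List.nil_append, List.cons_append, List.head?_nil, List.head?_cons, List.tail_nil, List.tail_cons]
    refine .step ?_
    simp only [prog, exec, update_word, tapes, List.map_nil, List.map_cons,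
      List.nil_append, List.cons_append, List.head?_nil, List.head?_cons, List.tail_nil, List.tail_cons]
    have := ih ((x.1, !x.2) :: w)
    simpa [StdWord.inv] using this

theorem run_readW (X : StdWord n) (T : Scan n) :
    Run (prog D) (2 * X.length + 1)
      (some (.readW T.ctl), tapes i X T.A T.B a' b' l o)
      (some (.readA (X.foldl Scan.push T).ctl.2),
        tapes i [] (X.foldl Scan.push T).A (X.foldl Scan.push T).B a' b' l o) := by
  induction X generalizing T with
  | nil =>
    refine .step ?_
    simp only [prog, exec, update_word, tapes, List.map_nil, List.map_cons,
      List.nil_append, List.cons_append, List.head?_nil, List.head?_cons, List.tail_nil, List.tail_cons]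
    exact .refl _ _
  | cons x X ih =>
    refine .step ?_
    simp only [prog, exec, update_word, tapes, List.map_nil, List.map_cons,
      List.nil_append, List.cons_append, List.head?_nil, List.head?_cons, List.tail_nil, List.tail_cons]
    refine .step ?_
    simp only [prog, exec, update_scanA, update_scanB, tapes, List.map_nil, List.map_cons,
      List.nil_append, List.cons_append, List.head?_nil, List.head?_cons, List.tail_nil, List.tail_cons]
    exact ih (T.push x)

theorem run_readA (δ : ZMod 4) :
    Run (prog D) (2 * a.length + 1) (some (.readA δ), tapes i w a b a' b' l o)
      (some (.readB δ), tapes i w [] b (a.reverse ++ a') b' l o) := by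
  induction a generalizing a' with
  | nil =>
    refine .step ?_
    simp only [prog, exec, update_scanA, tapes, List.map_nil, List.map_cons,
      List.nil_append, List.cons_append, List.head?_nil, List.head?_cons, List.tail_nil, List.tail_cons]
    exact .refl _ _
  | cons y a ih =>
    refine .step ?_
    simp only [prog, exec, update_scanA, tapes, List.map_nil, List.map_cons,
      List.nil_append, List.cons_append, List.head?_nil, List.head?_cons, List.tail_nil, List.tail_cons]
    refine .step ?_
    simp only [prog, exec, update_queueA, tapes, List.map_nil, List.map_cons,
      List.nil_append, List.cons_append, List.head?_nil, List.head?_cons, List.tail_nil, List.tail_cons]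
    simpa using ih (y :: a')

theorem run_readB (δ : ZMod 4) :
    Run (prog D) (2 * b.length + 1) (some (.readB δ), tapes i w a b a' b' l o)
      (some (.readLeft δ), tapes i w a [] a' (b.reverse ++ b') l o) := by
  induction b generalizing b' with
  | nil =>
    refine .step ?_
    simp only [prog, exec, update_scanB, tapes, List.map_nil, List.map_cons,
      List.nil_append, List.cons_append, List.head?_nil, List.head?_cons, List.tail_nil, List.tail_cons]
    exact .refl _ _
  | cons d b ih =>
    refine .step ?_
    simp only [prog, exec, update_scanB, tapes, List.map_nil, List.map_cons,
      List.nil_append, List.cons_append, List.head?_nil, List.head?_cons, List.tail_nil, List.tail_cons]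
    refine .step ?_
    simp only [prog, exec, update_queueB, tapes, List.map_nil, List.map_cons,
      List.nil_append, List.cons_append, List.head?_nil, List.head?_cons, List.tail_nil, List.tail_cons]
    simpa using ih (d :: b')

theorem run_readLeft (δ : ZMod 4) (A₁ A₂ : List (Fin (n - 1) × ZMod 4))
    (h : A₁.length = b'.length) :
    Run (prog D) (3 * b'.length + 1)
      (some (.readLeft δ), tapes i w a b (A₁ ++ A₂) b' l o)
      (some (.readRight δ),
        tapes i w a b A₂ [] ((List.zipWith finishLeft A₁ b').reverse ++ l) o) := by
  induction b' generalizing A₁ l with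
  | nil =>
    obtain rfl := List.eq_nil_of_length_eq_zero h
    refine .step ?_
    simp only [prog, exec, update_queueB, tapes, List.map_nil, List.map_cons,
      List.nil_append, List.cons_append, List.head?_nil, List.head?_cons, List.tail_nil, List.tail_cons]
    exact .refl _ _
  | cons d b' ih =>
    obtain _ | ⟨y, A₁⟩ := A₁
    · simp at h
    refine .step ?_
    simp only [prog, exec, update_queueB, tapes, List.map_nil, List.map_cons,
      List.nil_append, List.cons_append, List.head?_nil, List.head?_cons, List.tail_nil, List.tail_cons]
    refine .step ?_
    simp only [prog, exec, update_queueA, tapes, List.map_nil, List.map_cons,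
      List.nil_append, List.cons_append, List.head?_nil, List.head?_cons, List.tail_nil, List.tail_cons]
    refine .step ?_
    simp only [prog, exec, update_left, tapes, List.map_nil, List.map_cons,
      List.nil_append, List.cons_append, List.head?_nil, List.head?_cons, List.tail_nil, List.tail_cons]
    simpa using ih (finishLeft y d :: l) A₁ (by simpa using h)

theorem run_readRight (δ : ZMod 4) :
    Run (prog D) (2 * a'.length + 2)
      (some (.readRight δ), tapes i w a b a' b' l o)
      (some .readOut, tapes i w a b [] b' l
        (none :: ((standardize D (a'.map (finishRight δ)).reverse).map some ++ o))) := by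
  induction a' generalizing o with
  | nil =>
    refine .step ?_
    simp only [prog, exec, update_queueA, tapes, List.map_nil, List.map_cons,
      List.nil_append, List.cons_append, List.head?_nil, List.head?_cons, List.tail_nil, List.tail_cons]
    refine .step ?_
    simp only [prog, exec, update_output, tapes, List.map_nil, List.map_cons,
      List.nil_append, List.cons_append, List.head?_nil, List.head?_cons, List.tail_nil, List.tail_cons]
    exact .refl _ _
  | cons y a' ih =>
    refine .step ?_
    simp only [prog, exec, update_queueA, tapes, List.map_nil, List.map_cons,
      List.nil_append, List.cons_append, List.head?_nil, List.head?_cons, List.tail_nil, List.tail_cons]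
    refine .step ?_
    simp only [prog, exec, update_output, tapes, List.map_nil, List.map_cons,
      List.nil_append, List.cons_append, List.head?_nil, List.head?_cons, List.tail_nil, List.tail_cons]
    simpa [standardize, mul_add] using ih ((standardizeLetter D (finishRight δ y)).map some ++ o)

theorem run_readOut :
    Run (prog D) (2 * l.length + 2) (some .readOut, tapes i w a b a' b' l o)
      (none, tapes i w a b a' b' [] ((standardize D l.reverse).map some ++ o)) := by
  induction l generalizing o with
  | nil =>
    refine .step ?_
    simp only [prog, exec, update_left, tapes, List.map_nil, List.map_cons,
      List.nil_append, List.cons_append, List.head?_nil, List.head?_cons, List.tail_nil, List.tail_cons]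
    refine .step ?_
    exact .refl _ _
  | cons z l ih =>
    refine .step ?_
    simp only [prog, exec, update_left, tapes, List.map_nil, List.map_cons,
      List.nil_append, List.cons_append, List.head?_nil, List.head?_cons, List.tail_nil, List.tail_cons]
    refine .step ?_
    simp only [prog, exec, update_output, tapes, List.map_nil, List.map_cons,
      List.nil_append, List.cons_append, List.head?_nil, List.head?_cons, List.tail_nil, List.tail_cons]
    simpa [standardize, mul_add] using ih ((standardizeLetter D z).map some ++ o)

end

theorem length_scan (V : StdWord n) : (scan V).A.length = V.length := by
  induction V using List.reverseRecOn with
  | nil => rfl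
  | append_singleton V x ih => simp [scan_concat, Scan.push, ih]

/-- Fixed standard division is computable in linear time. -/
theorem computableInLinearTime_stdDivision (D : Fin (n - 1) → PosWord n) :
    ComputableInLinearTime encodePair encodePair
      (fun w : StdWord n × StdWord n => stdDivision D (w.1 ++ w.2.inv)) := by
  -- For `N = |X| + |Y|` the loops take at most `13 N + 10` steps, and the input has length `N + 1`,
  -- so 20 is ample. The constant is independent of `D` because a whole word is written within one
  -- machine step.
  refine computableInLinearTime (prog D) (.readX (false, 0)) .input .output
    (Equiv.refl _) (Equiv.refl _) 20 fun ⟨X, Y⟩ => ?_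
  have h1 := run_readX (Y.map some) [] [] [] [] [] D X ⟨(false, 0), [], []⟩
  have h2 := run_readY [] (X.foldl Scan.push ⟨(false, 0), [], []⟩).A
    (X.foldl Scan.push ⟨(false, 0), [], []⟩).B [] [] [] [] D Y
    (X.foldl Scan.push ⟨(false, 0), [], []⟩).ctl
  have h3 := run_readW [] [] [] [] [] D (StdWord.inv Y) (X.foldl Scan.push ⟨(false, 0), [], []⟩)
  rw [← List.foldl_append] at h3
  change Run _ _ _ (some (Label.readA (scan (X ++ StdWord.inv Y)).ctl.2),
    tapes _ _ (scan (X ++ StdWord.inv Y)).A (scan (X ++ StdWord.inv Y)).B _ _ _ _) at h3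
  rw [List.append_nil] at h2
  have hl := length_scan (X ++ StdWord.inv Y)
  obtain ⟨A₁, A₂, hA, hB, hE⟩ := exists_extDivision_eq (X ++ StdWord.inv Y)
  have hs : stdDivision D (X ++ StdWord.inv Y) = _ := congrArg
    (fun E : List (PosExtLetter n) × List (PosExtLetter n) =>
      (standardize D E.1, standardize D E.2)) hE
  generalize scan (X ++ StdWord.inv Y) = T at *
  have h4 := run_readA [] [] T.A T.B [] [] [] [] D T.ctl.2
  have h5 := run_readB [] [] [] T.B T.A.reverse [] [] [] D T.ctl.2
  have h6 := run_readLeft [] [] [] [] T.B.reverse [] [] D T.ctl.2 A₁ A₂ (by simpa using hB)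
  rw [← hA] at h6
  have h7 := run_readRight [] [] [] [] A₂ [] (List.zipWith finishLeft A₁ T.B.reverse).reverse [] D
    T.ctl.2
  have h8 := run_readOut [] [] [] [] [] [] (List.zipWith finishLeft A₁ T.B.reverse).reverse
    (none :: (standardize D (A₂.map (finishRight T.ctl.2)).reverse).map some) D
  rw [List.append_nil] at h4 h5 h6 h7
  have h := ((((((h1.trans h2).trans h3).trans h4).trans h5).trans h6).trans h7).trans h8
  have e1 : (Function.update (fun _ => []) Stack.output
      ((encodePair (stdDivision D (X ++ StdWord.inv Y))).map (Equiv.refl _).symm) :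
        ∀ k, List (Alphabet n k)) =
      tapes [] [] [] [] [] [] [] ((standardize D
        (List.zipWith finishLeft A₁ T.B.reverse).reverse.reverse).map some ++
        none :: (standardize D (A₂.map (finishRight T.ctl.2)).reverse).map some) := by
    rw [hs, List.reverse_reverse]
    funext k
    cases k <;> simp [encodePair, tapes]
  have e2 : (Function.update (fun _ => []) Stack.input
      ((encodePair (X, Y)).map (Equiv.refl _).symm) : ∀ k, List (Alphabet n k)) =
      tapes (X.map some ++ none :: Y.map some) [] [] [] [] [] [] [] := by
    funext k
    cases k <;> simp [encodePair, tapes]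
  dsimp only
  rw [e1, e2]
  refine h.mono ?_
  have hA' := congrArg List.length hA
  simp only [List.length_append, List.length_reverse, StdWord.inv, List.length_map] at hA' hl
  simp only [encodePair, List.length_append, List.length_cons, List.length_map, List.length_reverse,
    List.length_zipWith, StdWord.inv]
  omega

end LinearDivision

theorem theorem5 (n : ℕ) :
    (∃ D : Fin (n - 1) → PosWord n, IsDeltaQuotient n D) ∧
    ∀ D : Fin (n - 1) → PosWord n, IsDeltaQuotient n D →
      (∀ V : StdWord n,
        V.toGroup =
          StdWord.toGroup ((stdDivision D V).1.toStd ++ (stdDivision D V).2.toStd.inv)) ∧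
      IsLinearTimeReduction encodePair encodePair
        (fun w : StdWord n × StdWord n => stdDivision D (w.1 ++ w.2.inv))
        (groupWordProblem n) (monoidWordProblem n) :=
  ⟨exists_isDeltaQuotient n, fun D hD =>
    ⟨fun V => (toGroup_stdDivision hD V).symm,
      LinearDivision.computableInLinearTime_stdDivision D, mem_groupWordProblem_iff hD⟩⟩
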